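/- **Setting.** Let $\mathcal H$ be a complex Hilbert space (for example the GNS space $\mathcal H_\omega$ of an equilibrium state $\omega$) with a unit vector $\Omega$, and let $Q$ be the orthogonal projection onto $(\mathbb C\Omega)^\perp$. Let $P=(P_0,P_1,P_2,P_3)=(L,P_1,P_2,P_3)$ be strongly commuting selfadjoint operators (the generators of the space-time translations, $L$ being the Liouvillian) which annihilate $\Omega$ and have purely absolutely continuous spectrum on $(\mathbb C\Omega)^\perp$. Let $X=(X^0,X^1,X^2,X^3)$ be strongly commuting selfadjoint operators on $(\mathbb C\Omega)^\perp$, extended by $0$ to $\mathbb C\Omega$, which are conjugate to $P$, i.e. $[X^\nu,P_\mu]=i\,\delta^\nu_\mu\mathbf 1$ on $(\mathbb C\Omega)^\perp$ in the Weyl form $e^{ip\cdot X}e^{ia\cdot P}=e^{-ip\cdot a}e^{ia\cdot P}e^{ip\cdot X}$ $(p,a\in\mathbb R^4)$. Let $\mathcal K$ be a second Hilbert space with data of the same kind; its coordinate operators are also denoted $X^\nu$. For $\mathbf E=(E_1,E_2,E_3)\in\mathbb R^3$ and $e\in\mathbb R$ put $$\Theta=(\Theta_{\mu\nu})=\begin{pmatrix}0&-E_1&-E_2&-E_3\\E_1&0&0&0\\E_2&0&0&0\\E_3&0&0&0\end{pmatrix},\qquad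 W_e=e^{-ie\Theta_{\mu\nu}X^\mu\otimes X^\nu}\ \text{ on }\ \mathcal H\otimes\mathcal K .$$ **Proposition.** The operator $W_e$ is unitary, and the following hold. (1) Let $\varphi$ be a normal state on $B(\mathcal K)$ such that every $X^\mu$ on $\mathcal K$ ($\mu=0,\dots,3$) has finite first absolute moment in $\varphi$, and let $E^{\mathbf X}$ be the joint spectral measure of $\mathbf X=(X^1,X^2,X^3)$ on $\mathcal K$. Then the deformed Liouvillian $$L_{e\Theta}:=(\iota\otimes\varphi)\big[W_e^{-1}(L\otimes\mathbf 1)W_e\big]$$ satisfies, with equality of domains, $$L_{e\Theta}=L+e\Big(\int_{\mathbb R^3}\mathbf E\cdot\mathbf x\;\varphi[dE^{\mathbf X}(\mathbf x)]\Big)Q .$$ Here $(\iota\otimes\varphi)[W_e^{-1}(L\otimes\mathbf 1)W_e]$ denotes the strong limit, as $R\to\infty$, of $(\iota\otimes\varphi)[W_e^{-1}(L_R\otimes\mathbf 1)W_e]$, where $L_R=L\,\mathbf 1_{[-R,R]}(L)$; its domain is the set of all vectors on which the limit exists. (2) For $k=1,2,3$ (no summation over $k$), as unbounded operators on $\mathcal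 H\otimes\mathcal K$, $$e^{i\Theta_{\mu\nu}X^\mu\otimes X^\nu}(P_k\otimes\mathbf 1)e^{-i\Theta_{\mu\nu}X^\mu\otimes X^\nu}=e^{iE_kX^k\otimes X^0}(P_k\otimes\mathbf 1)e^{-iE_kX^k\otimes X^0}=\overline{P_k\otimes\mathbf 1-E_k\,Q\otimes X^0},$$ where the bar denotes the closure. On $(\mathbb C\Omega)^\perp\otimes\mathcal K$ the right-hand side is $P_k\otimes\mathbf 1-E_k\mathbf 1\otimes X^0$ (closed). -/

import Mathlib

open MeasureTheory Filter Topology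
open scoped TensorProduct InnerProductSpace ENNReal

noncomputable section

/-! ## Projection-valued measures -/

/-- A projection-valued measure (spectral measure) on `α` with values in `B(H)`: a strongly
countably additive map from measurable sets to orthogonal projections.
Values on non-measurable sets are irrelevant. -/
structure PVM (α : Type*) [MeasurableSpace α] (H : Type*)
    [NormedAddCommGroup H] [InnerProductSpace ℂ H] [CompleteSpace H] where
  proj : Set α → H →L[ℂ] H
  isStarProjection : ∀ s, MeasurableSet s → IsStarProjection (proj s)
  proj_univ : proj Set.univ = 1
  proj_inter : ∀ s t, MeasurableSet s → MeasurableSet t → proj (s ∩ t) = proj s * proj t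
  hasSum_proj : ∀ f : ℕ → Set α, (∀ i, MeasurableSet (f i)) → Pairwise (Function.onFun Disjoint f) →
    ∀ ψ : H, HasSum (fun i => proj (f i) ψ) (proj (⋃ i, f i) ψ)

namespace PVM

variable {α β H K : Type*} [MeasurableSpace α] [MeasurableSpace β]
  [NormedAddCommGroup H] [InnerProductSpace ℂ H] [CompleteSpace H]
  [NormedAddCommGroup K] [InnerProductSpace ℂ K] [CompleteSpace K]

theorem proj_empty (E : PVM α H) : E.proj ∅ = 0 := by
  ext ψ
  have h := E.hasSum_proj (fun _ => ∅) (fun _ => MeasurableSet.empty)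
    (fun _ _ _ => by simp [Function.onFun]) ψ
  have h2 := h.summable.tendsto_atTop_zero
  simpa using tendsto_nhds_unique tendsto_const_nhds h2

theorem re_inner_proj_nonneg (E : PVM α H) (ψ : H) (s : Set α) (hs : MeasurableSet s) :
    0 ≤ (⟪ψ, E.proj s ψ⟫_ℂ).re := by
  have h := E.isStarProjection s hs
  have h1 : E.proj s ψ = E.proj s (E.proj s ψ) := by
    conv_lhs => rw [← h.isIdempotentElem.eq]
    rfl
  have h2 : ⟪ψ, E.proj s (E.proj s ψ)⟫_ℂ = ⟪E.proj s ψ, E.proj s ψ⟫_ℂ := by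
    have h3 := h.isSelfAdjoint.adjoint_eq
    calc ⟪ψ, E.proj s (E.proj s ψ)⟫_ℂ
        = ⟪ψ, (E.proj s).adjoint (E.proj s ψ)⟫_ℂ := by rw [h3]
      _ = _ := ContinuousLinearMap.adjoint_inner_right _ _ _
  rw [h1, h2]
  exact inner_self_nonneg (𝕜 := ℂ)

/-- The spectral distribution `s ↦ ⟪ψ, E(s) ψ⟫` of the vector `ψ`, a measure of mass `‖ψ‖²`. -/
def measure (E : PVM α H) (ψ : H) : Measure α :=
  Measure.ofMeasurable (fun s _ => ENNReal.ofReal (⟪ψ, E.proj s ψ⟫_ℂ).re)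
    (by simp [E.proj_empty])
    (by
      intro f hf hd
      have h := E.hasSum_proj f hf hd ψ
      have h1 : HasSum (fun i => (⟪ψ, E.proj (f i) ψ⟫_ℂ).re)
          (⟪ψ, E.proj (⋃ i, f i) ψ⟫_ℂ).re :=
        Complex.hasSum_re (h.mapL (innerSL ℂ ψ))
      rw [← h1.tsum_eq]
      exact ENNReal.ofReal_tsum_of_nonneg
        (fun i => E.re_inner_proj_nonneg ψ _ (hf i)) h1.summable)

/-- The push-forward `s ↦ E(g⁻¹ s)` of a spectral measure under a measurable map. -/
def map (E : PVM α H) (g : α → β) (hg : Measurable g) : PVM β H where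
  proj s := E.proj (g ⁻¹' s)
  isStarProjection s hs := E.isStarProjection _ (hg hs)
  proj_univ := by simp [E.proj_univ]
  proj_inter s t hs ht := by rw [Set.preimage_inter, E.proj_inter _ _ (hg hs) (hg ht)]
  hasSum_proj f hf hd ψ := by
    rw [Set.preimage_iUnion]
    exact E.hasSum_proj _ (fun i => hg (hf i)) (fun i j hij => (hd hij).preimage g) ψ

open Classical in
/-- The functional calculus `∫ f dE` for a bounded measurable function `f`: the unique bounded
operator `T` with `⟪ψ, T ψ⟫ = ∫ f(x) ⟪ψ, dE(x) ψ⟫` for all `ψ`. -/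
def integral (E : PVM α H) (f : α → ℂ) : H →L[ℂ] H :=
  if h : ∃ T : H →L[ℂ] H, ∀ ψ, ⟪ψ, T ψ⟫_ℂ = ∫ x, f x ∂E.measure ψ then h.choose else 0

/-- The bounded truncation `∫_{[-R,R]} t dE(t)` of the selfadjoint operator `∫ t dE(t)`. -/
def truncation (E : PVM ℝ H) (R : ℝ) : H →L[ℂ] H :=
  E.integral fun t => (((Set.Icc (-R) R).indicator (fun u => u) t : ℝ) : ℂ)

/-- The unitary `e^{i p·A} = ∫ e^{i p·x} dE(x)`, where `E` is the joint spectral measure of `A`. -/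
def exp {n : ℕ} (E : PVM (Fin n → ℝ) H) (p : Fin n → ℝ) : H →L[ℂ] H :=
  E.integral fun x => Complex.exp (Complex.I * ((∑ μ, p μ * x μ : ℝ) : ℂ))

end PVM

/-- An `n`-tuple of (strongly) commuting, in general unbounded, selfadjoint operators
`A_μ = ∫ x_μ dE(x)`, with `E` their joint spectral measure on `ℝⁿ`.  The domain of `A_μ` is
`{ψ | ∫ x_μ² ⟪ψ, dE(x) ψ⟫ < ∞}` and `⟪ψ, A_μ ψ⟫ = ∫ x_μ ⟪ψ, dE(x) ψ⟫` on it. -/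
structure CommutingTuple (n : ℕ) (H : Type*)
    [NormedAddCommGroup H] [InnerProductSpace ℂ H] [CompleteSpace H] where
  op : Fin n → H →ₗ.[ℂ] H
  spec : PVM (Fin n → ℝ) H
  mem_domain_iff : ∀ μ ψ, ψ ∈ (op μ).domain ↔ Integrable (fun x => x μ ^ 2) (spec.measure ψ)
  inner_op : ∀ μ (ψ : (op μ).domain),
    ⟪(ψ : H), op μ ψ⟫_ℂ = ((∫ x, x μ ∂spec.measure (ψ : H) : ℝ) : ℂ)

/-! ## Systems in equilibrium -/

/-- The data on the Hilbert space `H` of an equilibrium representation.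
* `Ω` is the unit vector implementing the state.
* `P = (L, P₁, P₂, P₃)` are the generators of the space-time translations.  They annihilate `Ω`
  and have purely absolutely continuous spectrum on `(ℂΩ)^⊥`.
* `X = (X⁰, X¹, X², X³)` are the conjugate operators on `(ℂΩ)^⊥`, extended by `0` to `ℂΩ`.
  The commutation relations `[X^ν, P_μ] = i δ^ν_μ` on `(ℂΩ)^⊥` are in Weyl form. -/
structure EquilibriumSystem (H : Type*)
    [NormedAddCommGroup H] [InnerProductSpace ℂ H] [CompleteSpace H] where
  Ω : H
  norm_Ω : ‖Ω‖ = 1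
  P : CommutingTuple 4 H
  X : CommutingTuple 4 H
  P_Ω : ∀ μ, ∃ h : Ω ∈ (P.op μ).domain, P.op μ ⟨Ω, h⟩ = 0
  P_ac : ∀ μ ψ, ⟪Ω, ψ⟫_ℂ = 0 → (P.spec.measure ψ).map (fun x => x μ) ≪ volume
  X_Ω : ∀ μ, ∃ h : Ω ∈ (X.op μ).domain, X.op μ ⟨Ω, h⟩ = 0
  weyl : ∀ (p a : Fin 4 → ℝ) (ψ : H), ⟪Ω, ψ⟫_ℂ = 0 →
    X.spec.exp p (P.spec.exp a ψ) =
      Complex.exp (-Complex.I * ((∑ μ, p μ * a μ : ℝ) : ℂ)) • P.spec.exp a (X.spec.exp p ψ)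

namespace EquilibriumSystem

variable {H : Type*} [NormedAddCommGroup H] [InnerProductSpace ℂ H] [CompleteSpace H]

/-- The Liouvillian, i.e. the generator of time translations. -/
def L (S : EquilibriumSystem H) : H →ₗ.[ℂ] H := S.P.op 0

/-- The spectral measure of the Liouvillian. -/
def specL (S : EquilibriumSystem H) : PVM ℝ H :=
  S.P.spec.map (fun x => x 0) (measurable_pi_apply 0)

/-- The joint spectral measure of the spatial coordinate operators `(X¹, X², X³)`. -/
def specXSpatial (S : EquilibriumSystem H) : PVM (Fin 3 → ℝ) H :=
  S.X.spec.map (fun x k => x k.succ) (by fun_prop)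

/-- The orthogonal projection onto `(ℂΩ)^⊥`, i.e. the identity operator of `(ℂΩ)^⊥` extended
by `0` to `ℂΩ`. -/
def Q (S : EquilibriumSystem H) : H →L[ℂ] H := (ℂ ∙ S.Ω)ᗮ.starProjection

end EquilibriumSystem

/-! ## The composite system -/

/-- The Hilbert space tensor product. -/
abbrev HilbertTensor (H K : Type*) [NormedAddCommGroup H] [InnerProductSpace ℂ H]
    [NormedAddCommGroup K] [InnerProductSpace ℂ K] : Type _ :=
  UniformSpace.Completion (H ⊗[ℂ] K)

section Composite

variable {H K : Type*} [NormedAddCommGroup H] [InnerProductSpace ℂ H] [CompleteSpace H]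
  [NormedAddCommGroup K] [InnerProductSpace ℂ K] [CompleteSpace K]

/-- The elementary tensor `ψ ⊗ η` in the Hilbert space tensor product. -/
def elem (ψ : H) (η : K) : HilbertTensor H K := ((ψ ⊗ₜ[ℂ] η : H ⊗[ℂ] K) : HilbertTensor H K)

/-- The bounded map `ψ ↦ ψ ⊗ η`. -/
def insertRight (H : Type*) [NormedAddCommGroup H] [InnerProductSpace ℂ H] (η : K) :
    H →L[ℂ] HilbertTensor H K :=
  UniformSpace.Completion.toComplL ∘L (TensorProduct.mkL ℂ H K).flip η

/-- The bounded operator `T ⊗ 1`. -/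
def tensorOne (K : Type*) [NormedAddCommGroup K] [InnerProductSpace ℂ K] (T : H →L[ℂ] H) :
    HilbertTensor H K →L[ℂ] HilbertTensor H K :=
  (T.rTensor K).completion

/-- The tensor product `A ⊗ B` of unbounded operators: the closure of the operator
`ψ ⊗ η ↦ A ψ ⊗ B η` on the linear span of the `ψ ⊗ η`, `ψ ∈ dom A`, `η ∈ dom B`. -/
def tensorOp (A : H →ₗ.[ℂ] H) (B : K →ₗ.[ℂ] K) : HilbertTensor H K →ₗ.[ℂ] HilbertTensor H K :=
  (Submodule.span ℂ {z : HilbertTensor H K × HilbertTensor H K |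
    ∃ (ψ : A.domain) (η : B.domain),
      z = (elem (ψ : H) (η : K), elem (A ψ) (B η))}).topologicalClosure.toLinearPMap

/-- A bounded operator as an everywhere defined unbounded operator. -/
def boundedOp {G : Type*} [NormedAddCommGroup G] [InnerProductSpace ℂ G] (T : G →L[ℂ] G) :
    G →ₗ.[ℂ] G :=
  (T : G →ₗ[ℂ] G).toPMap ⊤

/-- `W⁻¹ T W` for a unitary `W` (whose inverse is its adjoint), with domain `W⁻¹ (dom T)`. -/
def unitaryConj {G : Type*} [NormedAddCommGroup G] [InnerProductSpace ℂ G] [CompleteSpace G]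
    (W : G →L[ℂ] G) (T : G →ₗ.[ℂ] G) : G →ₗ.[ℂ] G where
  domain := T.domain.comap (W : G →ₗ[ℂ] G)
  toFun :=
    { toFun := fun ψ => W.adjoint (T ⟨W ψ, ψ.2⟩)
      map_add' := fun ψ χ => by
        rw [← map_add, ← LinearPMap.map_add]
        congr 2
        exact Subtype.ext (map_add W _ _)
      map_smul' := fun c ψ => by
        rw [RingHom.id_apply, ← map_smul, ← LinearPMap.map_smul]
        congr 2
        exact Subtype.ext (map_smul W _ _) }

open Classical in
/-- The unitary `exp(-i M_{μν} X^μ ⊗ Y^ν)` for a real matrix `M` and commuting tuples `X` on `H`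
and `Y` on `K`, i.e. `∫∫ e^{-i M_{μν} x^μ y^ν} dE^X(x) ⊗ dE^Y(y)`: the unique bounded operator
with these diagonal matrix elements on elementary tensors. -/
def interaction {m n : ℕ} (M : Matrix (Fin m) (Fin n) ℝ) (X : CommutingTuple m H)
    (Y : CommutingTuple n K) : HilbertTensor H K →L[ℂ] HilbertTensor H K :=
  if h : ∃ W : HilbertTensor H K →L[ℂ] HilbertTensor H K, ∀ (ψ : H) (η : K),
      ⟪elem ψ η, W (elem ψ η)⟫_ℂ =
        ∫ x, ∫ y, Complex.exp (-Complex.I * ((∑ μ, ∑ ν, M μ ν * x μ * y ν : ℝ) : ℂ))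
          ∂Y.spec.measure η ∂X.spec.measure ψ
  then h.choose else 0

/-! ## Normal states and the deformation of observables -/

/-- A normal state `φ(A) = ∑_j ⟪η_j, A η_j⟫` on `B(K)`, i.e. `φ(A) = Tr(ρ A)` with the density
operator `ρ = ∑_j |η_j⟩⟨η_j|`, `Tr ρ = ∑_j ‖η_j‖² = 1`. -/
structure NormalState (K : Type*) [NormedAddCommGroup K] [InnerProductSpace ℂ K] where
  vec : ℕ → K
  hasSum_vec : HasSum (fun j => ‖vec j‖ ^ 2) 1

namespace NormalState

/-- The value `φ(A)`. -/
def eval (φ : NormalState K) (A : K →L[ℂ] K) : ℂ := ∑' j, ⟪φ.vec j, A (φ.vec j)⟫_ℂ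

/-- The probability measure `φ[dE(x)]`, i.e. `s ↦ φ(E(s))`. -/
def distribution {α : Type*} [MeasurableSpace α] (φ : NormalState K) (E : PVM α K) : Measure α :=
  Measure.sum fun j => E.measure (φ.vec j)

/-- The slice map `ι ⊗ φ : B(H ⊗ K) → B(H)`, with
`⟪χ, (ι ⊗ φ)(A) ψ⟫ = ∑_j ⟪χ ⊗ η_j, A (ψ ⊗ η_j)⟫`. -/
def slice (φ : NormalState K) (A : HilbertTensor H K →L[ℂ] HilbertTensor H K) : H →L[ℂ] H :=
  ∑' j, (insertRight H (φ.vec j)).adjoint ∘L A ∘L insertRight H (φ.vec j)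

end NormalState

/-- The strong limit of the bounded operators `T R` as `R → ∞`, defined on all `ψ` for which
`T R ψ` converges. -/
def strongLimit (T : ℝ → H →L[ℂ] H) : H →ₗ.[ℂ] H :=
  Submodule.toLinearPMap
    { carrier := {z : H × H | Tendsto (fun R => T R z.1) atTop (𝓝 z.2)}
      add_mem' := fun {z w} hz hw => by
        have h : Tendsto (fun R => T R z.1 + T R w.1) atTop (𝓝 (z.2 + w.2)) :=
          Tendsto.add hz hw
        simpa using h
      zero_mem' := by simp
      smul_mem' := fun c z hz => by
        have h : Tendsto (fun R => c • T R z.1) atTop (𝓝 (c • z.2)) :=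
          Tendsto.const_smul hz c
        simpa using h }

/-- The deformation `T ↦ (ι ⊗ φ)[W⁻¹ (T ⊗ 1) W]`, evaluated at the unbounded selfadjoint operator
`T = ∫ t dE(t)` as the strong limit of its values at the truncations `∫_{[-R,R]} t dE(t)`. -/
def deformedOp (φ : NormalState K) (W : HilbertTensor H K →L[ℂ] HilbertTensor H K)
    (E : PVM ℝ H) : H →ₗ.[ℂ] H :=
  strongLimit fun R => φ.slice (W.adjoint ∘L tensorOne K (E.truncation R) ∘L W)

end Composite

/-- The deformation matrix `Θ` of a constant electric field. -/
def electricMatrix (E : Fin 3 → ℝ) : Matrix (Fin 4) (Fin 4) ℝ :=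
  !![0, -E 0, -E 1, -E 2;
     E 0, 0, 0, 0;
     E 1, 0, 0, 0;
     E 2, 0, 0, 0]

end

/-!
Everything is reduced to the decomposition of the interaction unitary over the spectrum of the
second factor, `W = ∫ e^{-i(My)·X} ⊗ dE^Y(y)`.  The integral is built as a strong limit of
integrals of simple functions (`exists_fiberIntegral`); it is unitary, and
`⟪W(ψ ⊗ η), (T ⊗ 1) W(ψ ⊗ η)⟫ = ∫ ⟪e^{-i(My)·X} ψ, T e^{-i(My)·X} ψ⟫ ⟪η, dE^Y(y) η⟫`
for every bounded `T` (`interaction_spec`).  A bounded operator on the tensor product is determined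
by its quadratic form on elementary tensors, so that this formula computes `W⁻¹ (T ⊗ 1) W`.

*The Liouvillian.*  By the Weyl relations and uniqueness of characteristic functions, `e^{-ip·X}`
translates the spectral distributions of `L` on `(ℂΩ)^⊥` by `-p₀`, while it fixes `Ω`.  If
`f 0 = 0`, the deformation of `f(L)` is therefore `G(L) Q`, where `G` averages the translates of
`f` with the distribution of `Y` in the state (`slice_conj_specL_integral`).  For the truncations
`f = t 1_{[-R,R]}(t)` these averages converge pointwise to `t + m`, with `m` the mean translation,
and are bounded by `|t|` plus a constant.  Dominated convergence gives strong convergence on the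
domain of `L`, and Fatou's lemma shows that a vector on which there is convergence belongs to the
domain (`strongLimit_integral_cutoffId`).

*The momenta.*  All operators in question are generators of unitary groups.  The group of
`P_k ⊗ 1` is `e^{iaP_k} ⊗ 1`, and by the fibre formula its conjugate is the product of
`e^{iaP_k} ⊗ 1` and `e^{-iaE_k Q ⊗ X⁰}` (`conj_leftGroup`); only the `k`-th row of the matrix
enters.  On the common domain the derivative of the product is that of
`P_k ⊗ 1 - E_k Q ⊗ X⁰`.  This operator is a core for the generator of the product, because the
spectral projections of `P_k` and `X⁰` onto bounded sets commute with the product group, converge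
strongly to `1` and map into the common domain
(`IsUnitaryGroup.topologicalClosure_eq_generatorGraph`, `closure_sub_eq_generator`).
-/

/-! ### Integrals of simple functions and limits of vectors -/

section Approximation

variable {α ι κ : Type*} [MeasurableSpace α]

theorem integral_comp_simpleFunc (μ : Measure α) [IsFiniteMeasure μ] (g : SimpleFunc α ι)
    (b : ι → ℂ) :
    ∫ x, b (g x) ∂μ = ∑ i ∈ g.range, (μ.real (g ⁻¹' {i}) : ℂ) * b i := by
  have h (x : α) : b (g x) = ∑ i ∈ g.range, (g ⁻¹' {i}).indicator (fun _ => b i) x := by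
    rw [Finset.sum_eq_single (g x)]
    · simp
    · intro i _ hi
      exact Set.indicator_of_notMem (by simpa using hi.symm) _
    · intro h
      exact absurd (g.mem_range_self x) h
  simp_rw [h]
  rw [integral_finsetSum _
    fun i _ => (integrable_const (b i)).indicator (g.measurableSet_fiber i)]
  refine Finset.sum_congr rfl fun i _ => ?_
  rw [integral_indicator_const _ (g.measurableSet_fiber i), Complex.real_smul]

theorem integral_comp_simpleFunc₂ (μ : Measure α) [IsFiniteMeasure μ] (g : SimpleFunc α ι)
    (h : SimpleFunc α κ) (B : ι → κ → ℂ) :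
    ∫ x, B (g x) (h x) ∂μ =
      ∑ i ∈ g.range, ∑ j ∈ h.range, (μ.real (g ⁻¹' {i} ∩ h ⁻¹' {j}) : ℂ) * B i j := by
  have hp (x : α) : B (g x) (h x) = ∑ i ∈ g.range, ∑ j ∈ h.range,
      (g ⁻¹' {i} ∩ h ⁻¹' {j}).indicator (fun _ => B i j) x := by
    rw [Finset.sum_eq_single (g x), Finset.sum_eq_single (h x)]
    · simp
    · intro i _ hi
      exact Set.indicator_of_notMem (fun hx => hi hx.2.symm) _
    · intro hx
      exact absurd (h.mem_range_self x) hx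
    · intro i _ hi
      exact Finset.sum_eq_zero fun j _ => Set.indicator_of_notMem (fun hx => hi hx.1.symm) _
    · intro hx
      exact absurd (g.mem_range_self x) hx
  have hm (i : ι) (j : κ) : MeasurableSet (g ⁻¹' {i} ∩ h ⁻¹' {j}) :=
    (g.measurableSet_fiber i).inter (h.measurableSet_fiber j)
  simp_rw [hp]
  rw [integral_finsetSum _ fun i _ => integrable_finsetSum _
    fun j _ => (integrable_const (B i j)).indicator (hm i j)]
  refine Finset.sum_congr rfl fun i _ => ?_
  rw [integral_finsetSum _ fun j _ => (integrable_const (B i j)).indicator (hm i j)]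
  refine Finset.sum_congr rfl fun j _ => ?_
  rw [integral_indicator_const _ (hm i j), Complex.real_smul]

variable {G V : Type*} [NormedAddCommGroup G] [InnerProductSpace ℂ G]
  [NormedAddCommGroup V] [InnerProductSpace ℂ V]

/-- Vectors whose mutual inner products are those of a dominated convergent sequence of functions
form a Cauchy sequence: all inner products converge to the same limit. -/
theorem cauchySeq_of_inner_eq_integral {μ : Measure α} [IsFiniteMeasure μ] {v : ℕ → G}
    {f : ℕ → α → V} {f' : α → V} {F : α → ℝ} (hF : Integrable (fun x => F x ^ 2) μ)
    (hf : ∀ n, StronglyMeasurable (f n)) (hC : ∀ n x, ‖f n x‖ ≤ F x)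
    (hlim : ∀ x, Tendsto (fun n => f n x) atTop (𝓝 (f' x)))
    (hv : ∀ n m, ⟪v n, v m⟫_ℂ = ∫ x, ⟪f n x, f m x⟫_ℂ ∂μ) : CauchySeq v := by
  have key : Tendsto (fun p : ℕ × ℕ => ⟪v p.1, v p.2⟫_ℂ) atTop
      (𝓝 (∫ x, ⟪f' x, f' x⟫_ℂ ∂μ)) := by
    simp_rw [hv]
    refine tendsto_integral_filter_of_dominated_convergence (fun x => F x ^ 2) ?_ ?_ hF ?_
    · exact .of_forall fun p =>
        ((hf p.1).inner (hf p.2)).aestronglyMeasurable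
    · exact .of_forall fun p => .of_forall fun x => (norm_inner_le_norm _ _).trans <| by
        rw [sq]
        exact mul_le_mul (hC _ _) (hC _ _) (norm_nonneg _) ((norm_nonneg _).trans (hC p.1 x))
    · refine .of_forall fun x => ?_
      rw [← prod_atTop_atTop_eq]
      exact ((hlim x).comp tendsto_fst).inner ((hlim x).comp tendsto_snd)
  have hd : Tendsto (fun p : ℕ × ℕ => ‖v p.1 - v p.2‖ ^ 2) atTop (𝓝 0) := by
    have hpair {a b : ℕ × ℕ → ℕ} (ha : Tendsto a (atTop ×ˢ atTop) atTop)
        (hb : Tendsto b (atTop ×ˢ atTop) atTop) :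
        Tendsto (fun p => (a p, b p)) atTop (atTop : Filter (ℕ × ℕ)) := by
      rw [← prod_atTop_atTop_eq]
      exact ha.prodMk hb
    have h11 := key.comp (hpair tendsto_fst tendsto_fst)
    have h22 := key.comp (hpair tendsto_snd tendsto_snd)
    have h21 := key.comp (hpair tendsto_snd tendsto_fst)
    have h := (Complex.continuous_re.tendsto _).comp (((h11.sub key).sub h21).add h22)
    simp only [sub_self, zero_sub, neg_add_cancel, Complex.zero_re] at h
    refine h.congr fun p => ?_
    rw [← inner_self_eq_norm_sq (𝕜 := ℂ)]
    simp only [Function.comp_apply, inner_sub_left, inner_sub_right, RCLike.re_to_complex]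
    congr 1
    ring
  rw [cauchySeq_iff_tendsto_dist_atTop_0]
  have := hd.sqrt
  simpa [dist_eq_norm] using this

end Approximation

/-! ### Functional calculus of a spectral measure -/

section

variable {H : Type*} [NormedAddCommGroup H] [InnerProductSpace ℂ H]

/-- A bounded operator is determined by its quadratic form. -/
theorem ContinuousLinearMap.ext_inner_self {S T : H →L[ℂ] H}
    (h : ∀ ψ, ⟪ψ, S ψ⟫_ℂ = ⟪ψ, T ψ⟫_ℂ) : S = T := by
  have h0 : ((S - T : H →L[ℂ] H) : H →ₗ[ℂ] H) = 0 := by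
    rw [← inner_map_self_eq_zero]
    intro x
    rw [← inner_conj_symm]
    simp [inner_sub_right, h]
  ext ψ
  have := LinearMap.congr_fun h0 ψ
  simpa [sub_eq_zero] using this

end

/-- A bounded measurable complex function, the argument of the functional calculus. -/
structure BoundedMeasurable {α : Type*} [MeasurableSpace α] (f : α → ℂ) : Prop where
  measurable : Measurable f
  bounded : ∃ C, ∀ x, ‖f x‖ ≤ C

namespace BoundedMeasurable

variable {α β : Type*} [MeasurableSpace α] [MeasurableSpace β] {f h : α → ℂ}

theorem const (c : ℂ) : BoundedMeasurable (fun _ : α => c) :=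
  ⟨measurable_const, ‖c‖, fun _ => le_rfl⟩

theorem sub (hf : BoundedMeasurable f) (hh : BoundedMeasurable h) :
    BoundedMeasurable fun x => f x - h x := by
  obtain ⟨C, hC⟩ := hf.bounded
  obtain ⟨D, hD⟩ := hh.bounded
  exact ⟨hf.measurable.sub hh.measurable, C + D,
    fun x => (norm_sub_le _ _).trans (add_le_add (hC x) (hD x))⟩

theorem mul (hf : BoundedMeasurable f) (hh : BoundedMeasurable h) :
    BoundedMeasurable fun x => f x * h x := by
  obtain ⟨C, hC⟩ := hf.bounded
  obtain ⟨D, hD⟩ := hh.bounded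
  exact ⟨hf.measurable.mul hh.measurable, C * D, fun x => (norm_mul_le _ _).trans
    (mul_le_mul (hC x) (hD x) (norm_nonneg _) ((norm_nonneg _).trans (hC x)))⟩

theorem conj (hf : BoundedMeasurable f) :
    BoundedMeasurable fun x => (starRingEnd ℂ) (f x) := by
  obtain ⟨C, hC⟩ := hf.bounded
  exact ⟨Complex.continuous_conj.measurable.comp hf.measurable, C, fun x => by simpa using hC x⟩

theorem comp {g : β → α} (hf : BoundedMeasurable f) (hg : Measurable g) :
    BoundedMeasurable fun x => f (g x) := by
  obtain ⟨C, hC⟩ := hf.bounded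
  exact ⟨hf.measurable.comp hg, C, fun x => hC (g x)⟩

theorem indicator {s : Set α} (hf : BoundedMeasurable f) (hs : MeasurableSet s) :
    BoundedMeasurable (s.indicator f) := by
  obtain ⟨C, hC⟩ := hf.bounded
  exact ⟨hf.measurable.indicator hs, C, fun x => (norm_indicator_le_norm_self f x).trans (hC x)⟩

theorem integrable (hf : BoundedMeasurable f) (μ : Measure α) [IsFiniteMeasure μ] :
    Integrable f μ := by
  obtain ⟨C, hC⟩ := hf.bounded
  exact .of_bound hf.measurable.aestronglyMeasurable C (.of_forall hC)

end BoundedMeasurable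

namespace PVM

variable {α β ι H : Type*} [MeasurableSpace α] [MeasurableSpace β]
  [NormedAddCommGroup H] [InnerProductSpace ℂ H] [CompleteSpace H] (E : PVM α H)

theorem inner_proj_comm {s : Set α} (hs : MeasurableSet s) (ψ χ : H) :
    ⟪E.proj s ψ, χ⟫_ℂ = ⟪ψ, E.proj s χ⟫_ℂ := by
  conv_lhs => rw [← (E.isStarProjection s hs).isSelfAdjoint.adjoint_eq]
  exact ContinuousLinearMap.adjoint_inner_left _ _ _

theorem measure_apply (ψ : H) {s : Set α} (hs : MeasurableSet s) :
    E.measure ψ s = ENNReal.ofReal (⟪ψ, E.proj s ψ⟫_ℂ).re :=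
  Measure.ofMeasurable_apply s hs

instance (ψ : H) : IsFiniteMeasure (E.measure ψ) :=
  ⟨by rw [E.measure_apply ψ MeasurableSet.univ]; exact ENNReal.ofReal_lt_top⟩

theorem inner_proj_self (ψ : H) {s : Set α} (hs : MeasurableSet s) :
    ⟪ψ, E.proj s ψ⟫_ℂ = ((E.measure ψ).real s : ℂ) := by
  have hre : ((⟪ψ, E.proj s ψ⟫_ℂ).re : ℂ) = ⟪ψ, E.proj s ψ⟫_ℂ := by
    rw [← Complex.conj_eq_iff_re, inner_conj_symm, E.inner_proj_comm hs]
  rw [measureReal_def, E.measure_apply ψ hs,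
    ENNReal.toReal_ofReal (E.re_inner_proj_nonneg ψ s hs), hre]

theorem inner_proj_proj (ψ : H) {s t : Set α} (hs : MeasurableSet s) (ht : MeasurableSet t) :
    ⟪E.proj s ψ, E.proj t ψ⟫_ℂ = ((E.measure ψ).real (s ∩ t) : ℂ) := by
  rw [E.inner_proj_comm hs, ← E.inner_proj_self ψ (hs.inter ht), E.proj_inter s t hs ht]
  rfl

theorem measureReal_univ (ψ : H) : (E.measure ψ).real Set.univ = ‖ψ‖ ^ 2 := by
  have h := E.inner_proj_self ψ MeasurableSet.univ
  rw [E.proj_univ, one_apply_eq_self, inner_self_eq_norm_sq_to_K] at h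
  rw [← Complex.ofReal_inj, ← h]
  norm_num

theorem measure_map (ψ : H) {g : α → β} (hg : Measurable g) :
    (E.map g hg).measure ψ = (E.measure ψ).map g := by
  ext s hs
  rw [Measure.map_apply hg hs, measure_apply _ _ hs, measure_apply _ _ (hg hs)]
  rfl

/-- The integral of a simple function with respect to a spectral measure. -/
noncomputable def simpleIntegral (g : SimpleFunc α ℂ) : H →L[ℂ] H :=
  ∑ c ∈ g.range, c • E.proj (g ⁻¹' {c})

theorem inner_simpleIntegral_self (g : SimpleFunc α ℂ) (ψ : H) :
    ⟪ψ, E.simpleIntegral g ψ⟫_ℂ = ∫ x, g x ∂E.measure ψ := by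
  refine Eq.trans ?_ (integral_comp_simpleFunc (E.measure ψ) g id).symm
  simp only [simpleIntegral, sum_apply, inner_sum,
    smul_apply, inner_smul_right, E.inner_proj_self ψ (g.measurableSet_fiber _)]
  exact Finset.sum_congr rfl fun c _ => mul_comm _ _

theorem inner_simpleIntegral_simpleIntegral (g h : SimpleFunc α ℂ) (ψ : H) :
    ⟪E.simpleIntegral g ψ, E.simpleIntegral h ψ⟫_ℂ = ∫ x, ⟪g x, h x⟫_ℂ ∂E.measure ψ := by
  rw [integral_comp_simpleFunc₂ (E.measure ψ) g h fun c d => ⟪c, d⟫_ℂ]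
  simp only [simpleIntegral, sum_apply, inner_sum, sum_inner,
    smul_apply, inner_smul_right, inner_smul_left,
    E.inner_proj_proj ψ (g.measurableSet_fiber _) (h.measurableSet_fiber _)]
  rw [Finset.sum_comm]
  refine Finset.sum_congr rfl fun c _ => ?_
  rw [Finset.mul_sum]
  refine Finset.sum_congr rfl fun d _ => ?_
  simp only [RCLike.inner_apply]
  ring

variable {f h : α → ℂ}

theorem exists_simpleIntegral_tendsto (hf : BoundedMeasurable f) :
    ∃ (C : ℝ) (g : ℕ → SimpleFunc α ℂ), (∀ n x, ‖g n x‖ ≤ C) ∧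
      (∀ x, Tendsto (fun n => g n x) atTop (𝓝 (f x))) ∧
      ∀ ψ, Tendsto (fun n => E.simpleIntegral (g n) ψ) atTop (𝓝 (E.integral f ψ)) := by
  have hm := hf.measurable.stronglyMeasurable
  obtain ⟨C, hC⟩ := hf.bounded
  obtain ⟨g, hgC, hg⟩ : ∃ g : ℕ → SimpleFunc α ℂ, (∀ n x, ‖g n x‖ ≤ C) ∧
      ∀ x, Tendsto (fun n => g n x) atTop (𝓝 (f x)) :=
    ⟨hm.approxBounded C, fun n x => hm.norm_approxBounded_le ((norm_nonneg _).trans (hC x)) n x,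
      fun x => hm.tendsto_approxBounded_of_norm_le (hC x)⟩
  have hex (ψ : H) : ∃ y, Tendsto (fun n => E.simpleIntegral (g n) ψ) atTop (𝓝 y) :=
    cauchySeq_tendsto_of_complete <|
      cauchySeq_of_inner_eq_integral (F := fun _ => C) (integrable_const _)
        (fun n => (g n).stronglyMeasurable) hgC hg
        fun n m => E.inner_simpleIntegral_simpleIntegral (g n) (g m) ψ
  choose T hT using hex
  let T' : H →L[ℂ] H :=
    continuousLinearMapOfTendsto (fun n => E.simpleIntegral (g n)) (tendsto_pi_nhds.2 hT)
  have hT' (ψ : H) : ⟪ψ, T' ψ⟫_ℂ = ∫ x, f x ∂E.measure ψ := by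
    refine tendsto_nhds_unique (tendsto_const_nhds.inner (hT ψ)) ?_
    simp_rw [E.inner_simpleIntegral_self]
    exact tendsto_integral_of_dominated_convergence (fun _ => C)
      (fun n => (g n).stronglyMeasurable.aestronglyMeasurable) (integrable_const _)
      (fun n => .of_forall (hgC n)) (.of_forall hg)
  have hI : E.integral f = T' := by
    have hx : ∃ T : H →L[ℂ] H, ∀ ψ, ⟪ψ, T ψ⟫_ℂ = ∫ x, f x ∂E.measure ψ := ⟨T', hT'⟩
    rw [integral, dif_pos hx]
    exact ContinuousLinearMap.ext_inner_self fun ψ => by rw [hx.choose_spec, hT']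
  exact ⟨C, g, hgC, hg, fun ψ => by rw [hI]; exact hT ψ⟩

theorem inner_integral (hf : BoundedMeasurable f) (ψ : H) :
    ⟪ψ, E.integral f ψ⟫_ℂ = ∫ x, f x ∂E.measure ψ := by
  obtain ⟨C, g, hgC, hg, hlim⟩ := E.exists_simpleIntegral_tendsto hf
  refine tendsto_nhds_unique (tendsto_const_nhds.inner (hlim ψ)) ?_
  simp_rw [E.inner_simpleIntegral_self]
  exact tendsto_integral_of_dominated_convergence (fun _ => C)
    (fun n => (g n).stronglyMeasurable.aestronglyMeasurable) (integrable_const _)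
    (fun n => .of_forall (hgC n)) (.of_forall hg)

theorem inner_integral_integral (hf : BoundedMeasurable f) (hh : BoundedMeasurable h) (ψ : H) :
    ⟪E.integral f ψ, E.integral h ψ⟫_ℂ = ∫ x, ⟪f x, h x⟫_ℂ ∂E.measure ψ := by
  obtain ⟨C, u, huC, hu, hulim⟩ := E.exists_simpleIntegral_tendsto hf
  obtain ⟨D, v, hvD, hv, hvlim⟩ := E.exists_simpleIntegral_tendsto hh
  refine tendsto_nhds_unique ((hulim ψ).inner (hvlim ψ)) ?_
  simp_rw [E.inner_simpleIntegral_simpleIntegral]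
  refine tendsto_integral_of_dominated_convergence (fun _ => C * D)
    (fun n => ((u n).stronglyMeasurable.inner (v n).stronglyMeasurable).aestronglyMeasurable)
    (integrable_const _)
    (fun n => .of_forall fun x => (norm_inner_le_norm _ _).trans ?_)
    (.of_forall fun x => (hu x).inner (hv x))
  exact mul_le_mul (huC n x) (hvD n x) (norm_nonneg _) ((norm_nonneg _).trans (huC n x))

/-- The operator `∫ f dE` is characterized by its quadratic form. -/
theorem integral_eq_of_inner (hf : BoundedMeasurable f) {T : H →L[ℂ] H}
    (hT : ∀ ψ, ⟪ψ, T ψ⟫_ℂ = ∫ x, f x ∂E.measure ψ) : E.integral f = T :=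
  ContinuousLinearMap.ext_inner_self fun ψ => by rw [E.inner_integral hf, hT]

theorem integral_const (c : ℂ) : E.integral (fun _ => c) = c • 1 :=
  E.integral_eq_of_inner (.const c) fun ψ => by
    rw [MeasureTheory.integral_const, E.measureReal_univ]
    simp [inner_self_eq_norm_sq_to_K, mul_comm]

theorem integral_sub (hf : BoundedMeasurable f) (hh : BoundedMeasurable h) :
    E.integral (fun x => f x - h x) = E.integral f - E.integral h :=
  E.integral_eq_of_inner (hf.sub hh) fun ψ => by
    rw [sub_apply, inner_sub_right, E.inner_integral hf, E.inner_integral hh,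
      MeasureTheory.integral_sub (hf.integrable _) (hh.integrable _)]

theorem adjoint_integral (hf : BoundedMeasurable f) :
    (E.integral f).adjoint = E.integral fun x => (starRingEnd ℂ) (f x) := by
  refine (E.integral_eq_of_inner hf.conj fun ψ => ?_).symm
  rw [ContinuousLinearMap.adjoint_inner_right, ← inner_conj_symm, E.inner_integral hf,
    ← integral_conj]

theorem integral_mul (hf : BoundedMeasurable f) (hh : BoundedMeasurable h) :
    E.integral (fun x => f x * h x) = E.integral f * E.integral h := by
  refine E.integral_eq_of_inner (hf.mul hh) fun ψ => ?_
  rw [mul_apply_eq_comp, ← ContinuousLinearMap.adjoint_inner_left,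
    E.adjoint_integral hf, E.inner_integral_integral hf.conj hh]
  refine integral_congr_ae (.of_forall fun x => ?_)
  simp [RCLike.inner_apply, mul_comm]

theorem norm_sq_integral (hf : BoundedMeasurable f) (ψ : H) :
    ‖E.integral f ψ‖ ^ 2 = ∫ x, ‖f x‖ ^ 2 ∂E.measure ψ := by
  have h := E.inner_integral_integral hf hf ψ
  simp only [inner_self_eq_norm_sq_to_K] at h
  rw [← Complex.ofReal_inj, ← integral_complex_ofReal]
  push_cast
  exact h

theorem norm_sq_integral_sub (hf : BoundedMeasurable f) (hh : BoundedMeasurable h) (ψ : H) :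
    ‖E.integral f ψ - E.integral h ψ‖ ^ 2 = ∫ x, ‖f x - h x‖ ^ 2 ∂E.measure ψ := by
  rw [← E.norm_sq_integral (hf.sub hh), E.integral_sub hf hh]
  rfl

theorem integral_map {g : α → β} (hg : Measurable g) {f : β → ℂ} (hf : BoundedMeasurable f) :
    (E.map g hg).integral f = E.integral fun x => f (g x) := by
  refine (E.integral_eq_of_inner (hf.comp hg) fun ψ => ?_).symm
  rw [inner_integral _ hf, measure_map, MeasureTheory.integral_map hg.aemeasurable
    hf.measurable.aestronglyMeasurable]

theorem integral_indicator_one {s : Set α} (hs : MeasurableSet s) :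
    E.integral (s.indicator fun _ => 1) = E.proj s := by
  refine E.integral_eq_of_inner ((BoundedMeasurable.const 1).indicator hs) fun ψ => ?_
  rw [E.inner_proj_self ψ hs, integral_indicator_const _ hs]
  simp

theorem measure_proj (ψ : H) {s : Set α} (hs : MeasurableSet s) :
    E.measure (E.proj s ψ) = (E.measure ψ).restrict s := by
  ext t ht
  rw [Measure.restrict_apply ht, measure_apply _ _ ht, measure_apply _ _ (ht.inter hs),
    E.inner_proj_comm hs, E.proj_inter t s ht hs]
  congr 3
  have h1 : E.proj s * (E.proj t * E.proj s) = E.proj t * E.proj s := by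
    rw [← E.proj_inter t s ht hs, ← E.proj_inter s _ hs (ht.inter hs), Set.inter_comm t s,
      ← Set.inter_assoc, Set.inter_self]
  exact congrArg (fun T : H →L[ℂ] H => T ψ) h1

/-- Strong convergence of the functional calculus under bounded pointwise convergence. -/
theorem tendsto_integral_of_bounded {l : Filter ι} [l.IsCountablyGenerated] {F : ι → α → ℂ}
    {C : ℝ} (hF : ∀ i, Measurable (F i)) (hFC : ∀ i x, ‖F i x‖ ≤ C) (hf : Measurable f)
    (hC : ∀ x, ‖f x‖ ≤ C) (hlim : ∀ x, Tendsto (fun i => F i x) l (𝓝 (f x))) (ψ : H) :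
    Tendsto (fun i => E.integral (F i) ψ) l (𝓝 (E.integral f ψ)) := by
  rw [tendsto_iff_norm_sub_tendsto_zero]
  have h : Tendsto (fun i => ‖E.integral (F i) ψ - E.integral f ψ‖ ^ 2) l (𝓝 0) := by
    simp_rw [E.norm_sq_integral_sub ⟨hF _, C, hFC _⟩ ⟨hf, C, hC⟩]
    rw [show (0 : ℝ) = ∫ x, (0 : ℝ) ∂E.measure ψ by simp]
    refine tendsto_integral_filter_of_dominated_convergence (fun _ => (C + C) ^ 2) ?_ ?_ ?_ ?_
    · exact .of_forall fun i => (((hF i).sub hf).norm.pow_const 2).aestronglyMeasurable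
    · refine .of_forall fun i => .of_forall fun x => ?_
      rw [Real.norm_of_nonneg (by positivity)]
      exact pow_le_pow_left₀ (norm_nonneg _)
        ((norm_sub_le _ _).trans (add_le_add (hFC i x) (hC x))) 2
    · exact integrable_const _
    · refine .of_forall fun x => ?_
      simpa using ((hlim x).sub_const (f x)).norm.pow 2
  simpa using h.sqrt

end PVM

/-! ### Commuting tuples of selfadjoint operators -/

/-- The cut-off identity function `t ↦ t 1_{[-R,R]}(t)`. -/
noncomputable def cutoffId (R : ℝ) (t : ℝ) : ℂ :=
  (((Set.Icc (-R) R).indicator (fun u => u) t : ℝ) : ℂ)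

theorem cutoffId_of_abs_le {R t : ℝ} (h : |t| ≤ R) : cutoffId R t = t := by
  rw [cutoffId, Set.indicator_of_mem (Set.mem_Icc.2 (abs_le.1 h))]

theorem measurable_cutoffId (R : ℝ) : Measurable (cutoffId R) :=
  Complex.measurable_ofReal.comp (measurable_id.indicator measurableSet_Icc)

theorem norm_cutoffId_le_abs (R t : ℝ) : ‖cutoffId R t‖ ≤ |t| := by
  rw [cutoffId, Complex.norm_real]
  exact norm_indicator_le_norm_self _ t

theorem norm_cutoffId_le (R t : ℝ) : ‖cutoffId R t‖ ≤ |R| := by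
  by_cases h : t ∈ Set.Icc (-R) R
  · rw [cutoffId_of_abs_le (abs_le.2 h), Complex.norm_real]
    exact (abs_le.2 h).trans (le_abs_self R)
  · rw [cutoffId, Set.indicator_of_notMem h]
    simp

theorem tendsto_cutoffId (t : ℝ) : Tendsto (fun R => cutoffId R t) atTop (𝓝 (t : ℂ)) :=
  tendsto_const_nhds.congr' <| by
    filter_upwards [eventually_ge_atTop |t|] with R hR using (cutoffId_of_abs_le hR).symm

theorem tendsto_cutoffId_natCast (t : ℝ) :
    Tendsto (fun k : ℕ => cutoffId k t) atTop (𝓝 (t : ℂ)) :=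
  (tendsto_cutoffId t).comp tendsto_natCast_atTop_atTop

theorem BoundedMeasurable.cutoffId (R : ℝ) : BoundedMeasurable (cutoffId R) :=
  ⟨measurable_cutoffId R, |R|, norm_cutoffId_le R⟩

/-- A linear operator with vanishing quadratic form on a dense domain vanishes. -/
theorem LinearMap.eq_zero_of_inner_self_eq_zero {H : Type*} [NormedAddCommGroup H]
    [InnerProductSpace ℂ H] {D : Submodule ℂ H} (hD : Dense (D : Set H)) (B : D →ₗ[ℂ] H)
    (hB : ∀ ψ : D, ⟪(ψ : H), B ψ⟫_ℂ = 0) : B = 0 := by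
  -- Polarization: the form vanishes at `χ + ψ` and at `χ + iψ`.
  have hpol (χ ψ : D) : ⟪(χ : H), B ψ⟫_ℂ = 0 := by
    have h1 := hB (χ + ψ)
    have h2 := hB (χ + Complex.I • ψ)
    simp only [map_add, map_smul, Submodule.coe_add, Submodule.coe_smul, inner_add_left,
      inner_add_right, inner_smul_left, inner_smul_right, hB, Complex.conj_I] at h1 h2
    have hI := Complex.I_ne_zero
    have h3 : Complex.I * (⟪(χ : H), B ψ⟫_ℂ - ⟪(ψ : H), B χ⟫_ℂ) = 0 := by linear_combination h2
    have h4 := (mul_eq_zero.1 h3).resolve_left hI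
    linear_combination (h1 + h4) / 2
  ext ψ
  exact hD.eq_zero_of_inner_right (𝕜 := ℂ) fun χ hχ => hpol ⟨χ, hχ⟩ ψ

namespace CommutingTuple

variable {n : ℕ} {H ι : Type*} [NormedAddCommGroup H] [InnerProductSpace ℂ H] [CompleteSpace H]
  (A : CommutingTuple n H) (μ : Fin n)

/-- The set where the coordinate `μ` is at most `R` in absolute value. -/
def slab {n : ℕ} (μ : Fin n) (R : ℝ) : Set (Fin n → ℝ) := {x | |x μ| ≤ R}

theorem measurableSet_slab (R : ℝ) : MeasurableSet (slab μ R) :=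
  measurableSet_le (measurable_pi_apply μ).abs measurable_const

/-- The bounded operator `A_μ 1_{[-R,R]}(A_μ)`. -/
noncomputable def truncated (R : ℝ) : H →L[ℂ] H :=
  A.spec.integral fun x => cutoffId R (x μ)

theorem boundedMeasurable_cutoffId_apply (R : ℝ) :
    BoundedMeasurable fun x : Fin n → ℝ => cutoffId R (x μ) :=
  (BoundedMeasurable.cutoffId R).comp (measurable_pi_apply μ)

theorem proj_slab_mem_domain (R : ℝ) (ψ : H) : A.spec.proj (slab μ R) ψ ∈ (A.op μ).domain := by
  rw [A.mem_domain_iff, A.spec.measure_proj ψ (measurableSet_slab μ R)]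
  refine .of_bound ((measurable_pi_apply μ).pow_const 2).aestronglyMeasurable (R ^ 2) ?_
  filter_upwards [ae_restrict_mem (measurableSet_slab μ R)] with x hx
  rw [Real.norm_of_nonneg (sq_nonneg _), ← sq_abs]
  exact pow_le_pow_left₀ (abs_nonneg _) hx 2

theorem tendsto_proj_slab (ψ : H) :
    Tendsto (fun R : ℝ => A.spec.proj (slab μ R) ψ) atTop (𝓝 ψ) := by
  have h := A.spec.tendsto_integral_of_bounded (l := atTop) (C := 1)
    (F := fun R : ℝ => (slab μ R).indicator fun _ => (1 : ℂ)) (f := fun _ => 1)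
    (fun R => measurable_const.indicator (measurableSet_slab μ R))
    (fun R x => (norm_indicator_le_norm_self _ x).trans (by simp)) measurable_const (by simp)
    (fun x => tendsto_const_nhds.congr' ?_) ψ
  · simpa only [A.spec.integral_indicator_one (measurableSet_slab μ _), PVM.integral_const,
      one_smul, one_apply_eq_self] using h
  · filter_upwards [eventually_ge_atTop |x μ|] with R hR
    exact (Set.indicator_of_mem (show x ∈ slab μ R from hR) fun _ => (1 : ℂ)).symm

theorem dense_domain : Dense ((A.op μ).domain : Set H) := fun ψ =>
  mem_closure_of_tendsto (A.tendsto_proj_slab μ ψ)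
    (.of_forall fun R => A.proj_slab_mem_domain μ R ψ)

variable {A μ}

theorem integrable_sq {ψ : H} (hψ : ψ ∈ (A.op μ).domain) :
    Integrable (fun x => |x μ| ^ 2) (A.spec.measure ψ) := by
  simpa only [sq_abs] using (A.mem_domain_iff μ ψ).1 hψ

theorem integrable_quadratic {ψ : H} (hψ : ψ ∈ (A.op μ).domain) (a b : ℝ) :
    Integrable (fun x => a * |x μ| ^ 2 + b) (A.spec.measure ψ) :=
  ((integrable_sq hψ).const_mul a).add (integrable_const b)

theorem integrable_abs {ψ : H} (hψ : ψ ∈ (A.op μ).domain) :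
    Integrable (fun x => |x μ|) (A.spec.measure ψ) := by
  refine ((integrable_sq hψ).add (integrable_const 1)).mono'
    (measurable_pi_apply μ).abs.aestronglyMeasurable (.of_forall fun x => ?_)
  simp only [Real.norm_eq_abs, abs_abs, Pi.add_apply]
  nlinarith [sq_nonneg (|x μ| - 1), abs_nonneg (x μ)]

/-- The unbounded operator is the strong limit of its truncations on its domain.  The definition of
a tuple fixes only the quadratic form of the operator, so polarization is used. -/
theorem tendsto_truncated (ψ : (A.op μ).domain) :
    Tendsto (fun k : ℕ => A.truncated μ k ψ) atTop (𝓝 (A.op μ ψ)) := by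
  have hex (ψ : (A.op μ).domain) :
      ∃ y, Tendsto (fun k : ℕ => A.truncated μ k (ψ : H)) atTop (𝓝 y) := by
    refine cauchySeq_tendsto_of_complete <|
      cauchySeq_of_inner_eq_integral (V := ℂ) (f := fun (k : ℕ) x => cutoffId k (x μ))
        (f' := fun x => (x μ : ℂ)) (integrable_sq ψ.2)
        (fun k => (boundedMeasurable_cutoffId_apply μ _).measurable.stronglyMeasurable)
        (fun k x => norm_cutoffId_le_abs _ _)
        (fun x => tendsto_cutoffId_natCast (x μ))
        fun k l => ?_
    exact A.spec.inner_integral_integral (boundedMeasurable_cutoffId_apply μ _)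
      (boundedMeasurable_cutoffId_apply μ _) _
  choose f hf using hex
  let B : (A.op μ).domain →ₗ[ℂ] H := linearMapOfTendsto f
    (fun k : ℕ => (A.truncated μ k : H →ₗ[ℂ] H) ∘ₗ (A.op μ).domain.subtype) (tendsto_pi_nhds.2 hf)
  have hB : (A.op μ).toFun - B = 0 := by
    refine LinearMap.eq_zero_of_inner_self_eq_zero (A.dense_domain μ) _ fun ψ => ?_
    have h1 : ⟪(ψ : H), f ψ⟫_ℂ = ((∫ x, x μ ∂A.spec.measure (ψ : H) : ℝ) : ℂ) := by
      refine tendsto_nhds_unique (tendsto_const_nhds.inner (hf ψ)) ?_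
      rw [← integral_complex_ofReal]
      simp_rw [truncated, A.spec.inner_integral (boundedMeasurable_cutoffId_apply μ _)]
      exact tendsto_integral_of_dominated_convergence (fun x => |x μ|)
        (fun k => (boundedMeasurable_cutoffId_apply μ _).measurable.aestronglyMeasurable)
        (integrable_abs ψ.2) (fun k => .of_forall fun x => norm_cutoffId_le_abs _ _)
        (.of_forall fun x => tendsto_cutoffId_natCast (x μ))
    have h2 : ⟪(ψ : H), (A.op μ).toFun ψ⟫_ℂ = ⟪(ψ : H), f ψ⟫_ℂ := (A.inner_op μ ψ).trans h1.symm
    rw [LinearMap.sub_apply, inner_sub_right, h2]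
    exact sub_self _
  have h : A.op μ ψ = f ψ := sub_eq_zero.1 (LinearMap.congr_fun hB ψ)
  rw [h]
  exact hf ψ

/-- The distance between `A_μ ψ` and `f(A) ψ` is the `L²` distance between the coordinate and `f`
with respect to the spectral distribution of `ψ`. -/
theorem norm_sq_op_sub_integral (ψ : (A.op μ).domain) {f : (Fin n → ℝ) → ℂ}
    (hf : BoundedMeasurable f) :
    ‖A.op μ ψ - A.spec.integral f ψ‖ ^ 2 = ∫ x, ‖(x μ : ℂ) - f x‖ ^ 2 ∂A.spec.measure (ψ : H) := by
  obtain ⟨C, hC⟩ := hf.bounded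
  have hl : Tendsto (fun k : ℕ => ‖A.truncated μ k ψ - A.spec.integral f ψ‖ ^ 2) atTop
      (𝓝 (‖A.op μ ψ - A.spec.integral f ψ‖ ^ 2)) :=
    ((tendsto_truncated ψ).sub_const (A.spec.integral f ψ)).norm.pow 2
  have hk (k : ℕ) : ‖A.truncated μ k ψ - A.spec.integral f ψ‖ ^ 2 =
      ∫ x, ‖cutoffId k (x μ) - f x‖ ^ 2 ∂A.spec.measure (ψ : H) :=
    A.spec.norm_sq_integral_sub (boundedMeasurable_cutoffId_apply μ k) hf ψ
  refine tendsto_nhds_unique hl ?_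
  simp_rw [hk]
  refine tendsto_integral_of_dominated_convergence (fun x => 2 * |x μ| ^ 2 + 2 * C ^ 2)
    (fun k => (((boundedMeasurable_cutoffId_apply μ k).sub
      hf).measurable.norm.pow_const 2).aestronglyMeasurable)
    (integrable_quadratic ψ.2 _ _)
    (fun k => .of_forall fun x => ?_) (.of_forall fun x => ?_)
  · rw [Real.norm_of_nonneg (by positivity)]
    have h1 := norm_cutoffId_le_abs k (x μ)
    have h2 := hC x
    have h3 : ‖cutoffId k (x μ) - f x‖ ≤ |x μ| + C := (norm_sub_le _ _).trans (add_le_add h1 h2)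
    have h4 := pow_le_pow_left₀ (norm_nonneg _) h3 2
    nlinarith [sq_nonneg (|x μ| - C)]
  · exact ((tendsto_cutoffId_natCast (x μ)).sub_const (f x)).norm.pow 2

theorem op_proj_slab (R : ℝ) (ψ : H) :
    A.op μ ⟨A.spec.proj (slab μ R) ψ, A.proj_slab_mem_domain μ R ψ⟩ = A.truncated μ R ψ := by
  have hms := measurableSet_slab μ R
  have h := norm_sq_op_sub_integral ⟨A.spec.proj (slab μ R) ψ, A.proj_slab_mem_domain μ R ψ⟩
    (boundedMeasurable_cutoffId_apply μ R)
  have h0 : ∫ x, ‖(x μ : ℂ) - cutoffId R (x μ)‖ ^ 2 ∂A.spec.measure (A.spec.proj (slab μ R) ψ)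
      = 0 := by
    rw [A.spec.measure_proj ψ hms]
    refine integral_eq_zero_of_ae ?_
    filter_upwards [ae_restrict_mem hms] with x hx
    rw [cutoffId_of_abs_le hx]
    simp
  rw [h0] at h
  rw [sub_eq_zero.1 (norm_eq_zero.1 (pow_eq_zero_iff two_ne_zero |>.1 h))]
  have h1 : A.truncated μ R * A.spec.proj (slab μ R) = A.truncated μ R := by
    rw [truncated, ← A.spec.integral_indicator_one hms,
      ← A.spec.integral_mul (boundedMeasurable_cutoffId_apply μ R)
        ((BoundedMeasurable.const 1).indicator hms)]
    congr 1
    ext x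
    by_cases hx : x ∈ slab μ R
    · simp [hx]
    · have : x μ ∉ Set.Icc (-R) R := fun h => hx (abs_le.2 h)
      simp [hx, cutoffId, this]
  exact congrArg (fun T : H →L[ℂ] H => T ψ) h1

/-- Functions of the tuple that converge to a coordinate with at most linear growth converge
strongly to the operator on its domain. -/
theorem tendsto_integral_op {l : Filter ι} [l.IsCountablyGenerated]
    {F : ι → (Fin n → ℝ) → ℂ} {c d : ℝ} (hF : ∀ i, BoundedMeasurable (F i))
    (hb : ∀ᶠ i in l, ∀ x, ‖F i x‖ ≤ c * |x μ| + d)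
    (hlim : ∀ x, Tendsto (fun i => F i x) l (𝓝 (x μ : ℂ))) (ψ : (A.op μ).domain) :
    Tendsto (fun i => A.spec.integral (F i) ψ) l (𝓝 (A.op μ ψ)) := by
  have h : Tendsto (fun i => ‖A.op μ ψ - A.spec.integral (F i) ψ‖ ^ 2) l (𝓝 0) := by
    simp_rw [norm_sq_op_sub_integral ψ (hF _)]
    rw [show (0 : ℝ) = ∫ x, (0 : ℝ) ∂A.spec.measure (ψ : H) by simp]
    refine tendsto_integral_filter_of_dominated_convergence
      (fun x => 2 * (1 + c) ^ 2 * |x μ| ^ 2 + 2 * d ^ 2) ?_ ?_ ?_ ?_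
    · exact .of_forall fun i => ((((Complex.measurable_ofReal.comp (measurable_pi_apply μ)).sub
        (hF i).measurable).norm).pow_const 2).aestronglyMeasurable
    · filter_upwards [hb] with i hi
      refine .of_forall fun x => ?_
      rw [Real.norm_of_nonneg (by positivity)]
      have h3 : ‖(x μ : ℂ) - F i x‖ ≤ (1 + c) * |x μ| + d := by
        refine (norm_sub_le _ _).trans ?_
        rw [Complex.norm_real, Real.norm_eq_abs]
        linarith [hi x]
      have h4 := pow_le_pow_left₀ (norm_nonneg _) h3 2
      nlinarith [sq_nonneg ((1 + c) * |x μ| - d)]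
    · exact integrable_quadratic ψ.2 _ _
    · refine .of_forall fun x => ?_
      simpa using ((hlim x).const_sub (x μ : ℂ)).norm.pow 2
  rw [tendsto_iff_norm_sub_tendsto_zero]
  simp_rw [norm_sub_rev _ (A.op μ ψ)]
  simpa using h.sqrt

/-- If functions of the tuple that converge to a coordinate up to a constant converge on a vector,
then the vector belongs to the domain of the operator, by Fatou's lemma. -/
theorem mem_domain_of_tendsto {F : ℕ → (Fin n → ℝ) → ℂ} {m : ℂ}
    (hF : ∀ i, BoundedMeasurable (F i))
    (hlim : ∀ x, Tendsto (fun i => F i x) atTop (𝓝 ((x μ : ℂ) + m))) {ψ χ : H}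
    (h : Tendsto (fun i => A.spec.integral (F i) ψ) atTop (𝓝 χ)) : ψ ∈ (A.op μ).domain := by
  have hm : MemLp (fun x : Fin n → ℝ => (x μ : ℂ) + m) 2 (A.spec.measure ψ) := by
    obtain ⟨C, hC⟩ := h.norm.bddAbove_range
    have hC' (i : ℕ) : ‖A.spec.integral (F i) ψ‖ ≤ C := hC ⟨i, rfl⟩
    have hF2 (i : ℕ) : MemLp (F i) 2 (A.spec.measure ψ) := by
      obtain ⟨D, hD⟩ := (hF i).bounded
      exact .of_bound (hF i).measurable.aestronglyMeasurable D (.of_forall hD)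
    have hn (i : ℕ) : eLpNorm (F i) 2 (A.spec.measure ψ) ≤ ENNReal.ofReal C := by
      rw [(hF2 i).eLpNorm_eq_integral_rpow_norm (by norm_num) (by norm_num)]
      refine ENNReal.ofReal_le_ofReal ?_
      have := A.spec.norm_sq_integral (hF i) ψ
      simp only [ENNReal.toReal_ofNat, Real.rpow_ofNat]
      rw [← this, ← Real.rpow_natCast, ← Real.rpow_mul (norm_nonneg _)]
      simpa using hC' i
    refine ⟨((Complex.measurable_ofReal.comp
      (measurable_pi_apply μ)).add_const m).aestronglyMeasurable, ?_⟩
    refine lt_of_le_of_lt (Lp.eLpNorm_lim_le_liminf_eLpNorm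
      (fun i => (hF i).measurable.aestronglyMeasurable) _ (.of_forall hlim)) ?_
    refine lt_of_le_of_lt (liminf_le_of_le (by isBoundedDefault) (fun b hb => ?_))
      (ENNReal.ofReal_lt_top (r := C))
    obtain ⟨i, hi⟩ := hb.exists
    exact hi.trans (hn i)
  have h2 := hm.sub (memLp_const m)
  rw [A.mem_domain_iff]
  have h3 := (memLp_two_iff_integrable_sq_norm h2.1).1 h2
  refine h3.congr (.of_forall fun x => ?_)
  simp

/-- A vector annihilated by all operators of a tuple has spectral distribution concentrated at
`0`. -/
theorem integral_apply_of_op_eq_zero {Ω : H}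
    (hΩ : ∀ μ, ∃ h : Ω ∈ (A.op μ).domain, A.op μ ⟨Ω, h⟩ = 0) {f : (Fin n → ℝ) → ℂ}
    (hf : BoundedMeasurable f) : A.spec.integral f Ω = f 0 • Ω := by
  have h0 : ∀ᵐ x ∂A.spec.measure Ω, x = 0 := by
    have h1 (μ : Fin n) : ∀ᵐ x ∂A.spec.measure Ω, x μ = 0 := by
      obtain ⟨h, hz⟩ := hΩ μ
      have h2 := norm_sq_op_sub_integral ⟨Ω, h⟩ (BoundedMeasurable.const 0)
      rw [hz] at h2
      simp only [PVM.integral_const, zero_smul, zero_apply, sub_zero, norm_zero,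
        Complex.norm_real, Real.norm_eq_abs, ne_eq, OfNat.ofNat_ne_zero, not_false_eq_true,
        zero_pow] at h2
      have h3 := (integral_eq_zero_iff_of_nonneg (fun x => sq_nonneg _) (integrable_sq h)).1 h2.symm
      filter_upwards [h3] with x hx
      simpa using hx
    filter_upwards [ae_all_iff.2 h1] with x hx
    exact funext hx
  have h1 := A.spec.norm_sq_integral_sub hf (BoundedMeasurable.const (f 0)) Ω
  have h2 : ∫ x, ‖f x - f 0‖ ^ 2 ∂A.spec.measure Ω = 0 := by
    refine integral_eq_zero_of_ae ?_
    filter_upwards [h0] with x hx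
    simp [hx]
  rw [h2] at h1
  have h3 := sub_eq_zero.1 (norm_eq_zero.1 (pow_eq_zero_iff two_ne_zero |>.1 h1))
  rw [h3, PVM.integral_const]
  rfl

end CommutingTuple

/-! ### Exponentials of a commuting tuple -/

/-- The character `x ↦ e^{i p·x}`. -/
noncomputable def phase {n : ℕ} (p x : Fin n → ℝ) : ℂ :=
  Complex.exp (Complex.I * ((∑ μ, p μ * x μ : ℝ) : ℂ))

section Phase

variable {n : ℕ}

theorem norm_phase (p x : Fin n → ℝ) : ‖phase p x‖ = 1 := by
  rw [phase, Complex.norm_exp_I_mul_ofReal]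

theorem phase_add (p q x : Fin n → ℝ) : phase (p + q) x = phase p x * phase q x := by
  simp only [phase, ← Complex.exp_add, ← mul_add, ← Complex.ofReal_add, ← Finset.sum_add_distrib,
    Pi.add_apply, add_mul]

theorem phase_zero_left (x : Fin n → ℝ) : phase 0 x = 1 := by simp [phase]

theorem phase_zero_right (p : Fin n → ℝ) : phase p 0 = 1 := by simp [phase]

theorem conj_phase (p x : Fin n → ℝ) : (starRingEnd ℂ) (phase p x) = phase (-p) x := by
  simp only [phase, ← Complex.exp_conj, map_mul, Complex.conj_I, Complex.conj_ofReal, Pi.neg_apply,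
    neg_mul, Finset.sum_neg_distrib, Complex.ofReal_neg, mul_neg]

theorem phase_single (μ : Fin n) (a : ℝ) (x : Fin n → ℝ) :
    phase (Pi.single μ a) x = Complex.exp (Complex.I * ((a * x μ : ℝ) : ℂ)) := by
  rw [phase, Finset.sum_eq_single μ]
  · simp
  · intro ν _ hν
    simp [hν]
  · simp

theorem continuous_phase : Continuous fun z : (Fin n → ℝ) × (Fin n → ℝ) => phase z.1 z.2 := by
  unfold phase
  fun_prop

theorem boundedMeasurable_phase (p : Fin n → ℝ) : BoundedMeasurable (phase p) :=
  ⟨(continuous_phase.comp (Continuous.prodMk_right p)).measurable, 1,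
    fun x => (norm_phase p x).le⟩

end Phase

namespace PVM

variable {n : ℕ} {H : Type*} [NormedAddCommGroup H] [InnerProductSpace ℂ H] [CompleteSpace H]
  (E : PVM (Fin n → ℝ) H)

theorem exp_eq (p : Fin n → ℝ) : E.exp p = E.integral (phase p) := rfl

theorem exp_zero : E.exp 0 = 1 := by
  rw [exp_eq, show phase (0 : Fin n → ℝ) = fun _ => 1 from funext phase_zero_left, integral_const,
    one_smul]

theorem exp_add (p q : Fin n → ℝ) : E.exp (p + q) = E.exp p * E.exp q := by
  rw [exp_eq, exp_eq, exp_eq, ← E.integral_mul (boundedMeasurable_phase p)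
    (boundedMeasurable_phase q)]
  exact congrArg _ (funext (phase_add p q))

theorem adjoint_exp (p : Fin n → ℝ) : (E.exp p).adjoint = E.exp (-p) := by
  rw [exp_eq, exp_eq, E.adjoint_integral (boundedMeasurable_phase p)]
  exact congrArg _ (funext (conj_phase p))

theorem exp_exp_neg (p : Fin n → ℝ) (ψ : H) : E.exp p (E.exp (-p) ψ) = ψ := by
  rw [← mul_apply_eq_comp, ← exp_add, add_neg_cancel, exp_zero, one_apply_eq_self]

theorem norm_exp_apply (p : Fin n → ℝ) (ψ : H) : ‖E.exp p ψ‖ = ‖ψ‖ := by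
  have h := E.norm_sq_integral (boundedMeasurable_phase p) ψ
  simp only [norm_phase, one_pow, MeasureTheory.integral_const, E.measureReal_univ, smul_eq_mul,
    mul_one] at h
  exact (pow_left_inj₀ (norm_nonneg _) (norm_nonneg _) two_ne_zero).1 h

theorem continuous_exp_apply (ψ : H) : Continuous fun p => E.exp p ψ :=
  continuous_iff_continuousAt.2 fun p =>
    E.tendsto_integral_of_bounded (C := 1) (fun q => (boundedMeasurable_phase q).measurable)
      (fun q x => (norm_phase q x).le) (boundedMeasurable_phase p).measurable
      (fun x => (norm_phase p x).le)
      (fun x => (continuous_phase.comp (Continuous.prodMk_left x)).tendsto p) ψ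

theorem integral_mul_comm {f h : (Fin n → ℝ) → ℂ} (hf : BoundedMeasurable f)
    (hh : BoundedMeasurable h) : E.integral f * E.integral h = E.integral h * E.integral f := by
  rw [← E.integral_mul hf hh, ← E.integral_mul hh hf]
  exact congrArg _ (funext fun x => mul_comm _ _)

end PVM

/-- The difference quotients of `e^{iat}` at `a = 0` are bounded by `|t|`, so that the bound for
functions of linear growth applies. -/
theorem CommutingTuple.hasDerivAt_exp {n : ℕ} {H : Type*} [NormedAddCommGroup H]
    [InnerProductSpace ℂ H] [CompleteSpace H] (A : CommutingTuple n H) (μ : Fin n)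
    (ψ : (A.op μ).domain) :
    HasDerivAt (fun a : ℝ => A.spec.exp (Pi.single μ a) (ψ : H)) (Complex.I • A.op μ ψ) 0 := by
  rw [hasDerivAt_iff_tendsto_slope_zero]
  let F (t : ℝ) (x : Fin n → ℝ) : ℂ := (-Complex.I * (t : ℂ)⁻¹) * (phase (Pi.single μ t) x - 1)
  have hF (t : ℝ) : BoundedMeasurable (F t) :=
    (BoundedMeasurable.const _).mul ((boundedMeasurable_phase _).sub (.const 1))
  have hFI (t : ℝ) : A.spec.integral (F t) (ψ : H) =
      (-Complex.I * (t : ℂ)⁻¹) • (A.spec.exp (Pi.single μ t) (ψ : H) - ψ) := by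
    rw [A.spec.integral_mul (.const _) ((boundedMeasurable_phase _).sub (.const 1)),
      A.spec.integral_sub (boundedMeasurable_phase _) (.const 1), PVM.integral_const,
      PVM.integral_const, PVM.exp_eq]
    simp
  have h := CommutingTuple.tendsto_integral_op (l := 𝓝[≠] (0 : ℝ)) (c := 1) (d := 0) hF ?_ ?_ ψ
  · refine (h.const_smul Complex.I).congr fun t => ?_
    rw [hFI, smul_smul, zero_add, Pi.single_zero, A.spec.exp_zero, one_apply_eq_self,
      ← Complex.coe_smul, ← mul_assoc, mul_neg, Complex.I_mul_I, neg_neg, one_mul,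
      Complex.ofReal_inv]
  · filter_upwards [self_mem_nhdsWithin] with t ht x
    have ht' : 0 < |t| := abs_pos.2 ht
    have h1 := Real.norm_exp_I_mul_ofReal_sub_one_le (x := t * x μ)
    simp only [F, phase_single, norm_mul, norm_neg, Complex.norm_I, norm_inv, Complex.norm_real,
      one_mul, add_zero]
    rw [inv_mul_le_iff₀ (by simpa using ht)]
    simpa [abs_mul] using h1
  · intro x
    have h1 : HasDerivAt (fun t : ℝ => Complex.exp (Complex.I * ((t * x μ : ℝ) : ℂ)))
        (Complex.I * x μ) 0 := by
      have h2 : HasDerivAt (fun t : ℝ => Complex.I * ((t * x μ : ℝ) : ℂ)) (Complex.I * x μ) 0 := by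
        have := ((hasDerivAt_id (0 : ℝ)).mul_const (x μ)).ofReal_comp.const_mul Complex.I
        simpa using this
      simpa using h2.cexp
    rw [hasDerivAt_iff_tendsto_slope_zero] at h1
    have h3 := h1.const_mul (-Complex.I)
    rw [← mul_assoc, neg_mul, Complex.I_mul_I, neg_neg, one_mul] at h3
    refine h3.congr fun t => ?_
    simp [F, phase_single, mul_assoc]

/-! ### Generators of unitary groups -/

section Generator

variable {G : Type*} [NormedAddCommGroup G] [InnerProductSpace ℂ G]

/-- A one-parameter group of isometric operators. -/
structure IsUnitaryGroup (U : ℝ → G →L[ℂ] G) : Prop where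
  map_zero : U 0 = 1
  map_add : ∀ a b, U (a + b) = U a * U b
  norm_map : ∀ a z, ‖U a z‖ = ‖z‖

/-- The graph of the generator of `a ↦ U a`, i.e. the pairs `(z, w)` such that `U a z` has
derivative `i w` at `a = 0`. -/
noncomputable def generatorGraph (U : ℝ → G →L[ℂ] G) : Submodule ℂ (G × G) where
  carrier := {z | HasDerivAt (fun a => U a z.1) (Complex.I • z.2) 0}
  add_mem' {z w} hz hw := by
    have h : HasDerivAt (fun a => U a z.1 + U a w.1) (Complex.I • z.2 + Complex.I • w.2) 0 :=
      HasDerivAt.add hz hw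
    simpa using h
  zero_mem' := by simpa using hasDerivAt_const (0 : ℝ) (0 : G)
  smul_mem' c z hz := by
    have h : HasDerivAt (fun a => c • U a z.1) (c • Complex.I • z.2) 0 :=
      HasDerivAt.const_smul c hz
    rw [smul_comm c] at h
    simpa using h

theorem mem_generatorGraph {U : ℝ → G →L[ℂ] G} {z w : G} :
    (z, w) ∈ generatorGraph U ↔ HasDerivAt (fun a => U a z) (Complex.I • w) 0 := Iff.rfl

theorem generatorGraph_unique {U : ℝ → G →L[ℂ] G} {z w w' : G} (h : (z, w) ∈ generatorGraph U)
    (h' : (z, w') ∈ generatorGraph U) : w = w' :=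
  smul_right_injective G Complex.I_ne_zero (HasDerivAt.unique h h')

/-- The generator of `a ↦ U a`. -/
noncomputable def generator (U : ℝ → G →L[ℂ] G) : G →ₗ.[ℂ] G := (generatorGraph U).toLinearPMap

theorem graph_generator (U : ℝ → G →L[ℂ] G) : (generator U).graph = generatorGraph U :=
  Submodule.toLinearPMap_graph_eq _ fun x hx hx' =>
    generatorGraph_unique (z := 0) (by rw [← hx']; exact hx) (generatorGraph U).zero_mem

theorem ContinuousLinearMap.map_mem_generatorGraph {U U' : ℝ → G →L[ℂ] G} {T : G →L[ℂ] G}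
    (h : ∀ a, T * U a = U' a * T) {z w : G} (hz : (z, w) ∈ generatorGraph U) :
    (T z, T w) ∈ generatorGraph U' := by
  rw [mem_generatorGraph] at hz ⊢
  have h1 := ((T.restrictScalars ℝ).hasFDerivAt).comp_hasDerivAt 0 hz
  have h2 : (fun a => U' a (T z)) = T ∘ fun a => U a z := by
    funext a
    exact (congrArg (fun S : G →L[ℂ] G => S z) (h a)).symm
  rw [h2, ← map_smul]
  exact h1

namespace IsUnitaryGroup

variable {U : ℝ → G →L[ℂ] G}

theorem hasDerivAt (hU : IsUnitaryGroup U) {z w : G} (h : (z, w) ∈ generatorGraph U) (a : ℝ) :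
    HasDerivAt (fun a => U a z) (U a (Complex.I • w)) a := by
  have h1 : HasDerivAt (fun s => U s z) (Complex.I • w) (a - a) := by
    rw [sub_self]
    exact h
  have h2 := (((U a).restrictScalars ℝ).hasFDerivAt).comp_hasDerivAt a (h1.comp_sub_const a a)
  refine HasDerivAt.congr_of_eventuallyEq h2 (.of_forall fun t => ?_)
  change U t z = U a (U (t - a) z)
  rw [← mul_apply_eq_comp, ← hU.map_add, add_sub_cancel]

/-- The generator is closed: derivatives of the orbits converge uniformly in time. -/
theorem isClosed_generatorGraph (hU : IsUnitaryGroup U) :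
    IsClosed (generatorGraph U : Set (G × G)) := by
  refine isClosed_of_closure_subset fun p hp => ?_
  obtain ⟨s, hs, hlim⟩ := mem_closure_iff_seq_limit.1 hp
  have h1 : Tendsto (fun n => (s n).1) atTop (𝓝 p.1) := (continuous_fst.tendsto p).comp hlim
  have h2 : Tendsto (fun n => (s n).2) atTop (𝓝 p.2) := (continuous_snd.tendsto p).comp hlim
  have h := hasDerivAt_of_tendstoUniformly (l := atTop) (f := fun n a => U a (s n).1)
    (f' := fun n a => U a (Complex.I • (s n).2)) (g := fun a => U a p.1)
    (g' := fun a => U a (Complex.I • p.2)) ?_ (.of_forall fun n a => hU.hasDerivAt (hs n) a)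
    (fun a => ((U a).continuous.tendsto p.1).comp h1) 0
  · simp only [hU.map_zero, one_apply_eq_self] at h
    exact h
  · rw [Metric.tendstoUniformly_iff]
    intro ε hε
    filter_upwards [(Metric.tendsto_nhds.1 h2) ε hε] with n hn a
    rw [dist_eq_norm, ← map_sub, hU.norm_map, ← smul_sub, norm_smul, Complex.norm_I, one_mul,
      ← dist_eq_norm, dist_comm]
    exact hn

/-- A part `Γ` of the generator is a core as soon as there are bounded operators `F n` which
commute with the group, converge strongly to `1` and map everything into the closure of `Γ`. -/
theorem topologicalClosure_eq_generatorGraph (hU : IsUnitaryGroup U)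
    {Γ : Submodule ℂ (G × G)} (hΓ : Γ ≤ generatorGraph U)
    {F : ℕ → G →L[ℂ] G} (hF : ∀ z, Tendsto (fun n => F n z) atTop (𝓝 z))
    (hcomm : ∀ n a, F n * U a = U a * F n)
    (hΓF : ∀ n z, ∃ w, (F n z, w) ∈ Γ.topologicalClosure) :
    Γ.topologicalClosure = generatorGraph U := by
  have hle := Submodule.topologicalClosure_minimal _ hΓ hU.isClosed_generatorGraph
  refine le_antisymm hle fun p hp => ?_
  obtain ⟨z, w⟩ := p
  have hmem (n : ℕ) : (F n z, F n w) ∈ Γ.topologicalClosure := by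
    obtain ⟨w', hw'⟩ := hΓF n z
    rwa [generatorGraph_unique ((F n).map_mem_generatorGraph (hcomm n) hp) (hle hw')]
  exact Γ.isClosed_topologicalClosure.mem_of_tendsto ((hF z).prodMk_nhds (hF w))
    (.of_forall hmem)

end IsUnitaryGroup

/-- Product rule for a strongly continuous isometric family, which need not be norm continuous. -/
theorem hasDerivAt_apply_apply {U V : ℝ → G →L[ℂ] G} (hU : ∀ a z, ‖U a z‖ = ‖z‖)
    (hUc : ∀ z, Tendsto (fun a => U a z) (𝓝 0) (𝓝 z)) (hV : V 0 = 1) {z u v : G}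
    (hu : HasDerivAt (fun a => U a z) u 0) (hv : HasDerivAt (fun a => V a z) v 0) :
    HasDerivAt (fun a => U a (V a z)) (u + v) 0 := by
  have h : HasDerivAt (fun a => U a (V a z - z)) v 0 := by
    rw [hasDerivAt_iff_tendsto_slope_zero] at hv ⊢
    simp only [zero_add, hV, one_apply_eq_self, sub_self, map_zero, sub_zero] at hv ⊢
    rw [tendsto_iff_norm_sub_tendsto_zero] at hv ⊢
    have h1 := (tendsto_iff_norm_sub_tendsto_zero.1 (hUc v)).mono_left
      (nhdsWithin_le_nhds (s := {0}ᶜ))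
    refine squeeze_zero (fun _ => norm_nonneg _) (fun t => ?_) (by simpa using hv.add h1)
    have h2 : t⁻¹ • U t (V t z - z) - v = U t (t⁻¹ • (V t z - z) - v) + (U t v - v) := by
      rw [map_sub (U t) (t⁻¹ • (V t z - z)), ContinuousLinearMap.map_smul_of_tower, map_sub (U t),
        sub_add_sub_cancel]
    rw [h2]
    exact (norm_add_le _ _).trans_eq (by rw [hU])
  refine (hu.add h).congr_of_eventuallyEq (.of_forall fun a => ?_)
  simp

theorem unitaryConj_generator [CompleteSpace G] {W : G →L[ℂ] G} (hW : W ∈ unitary (G →L[ℂ] G))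
    (U : ℝ → G →L[ℂ] G) :
    unitaryConj W (generator U) = generator fun a => W.adjoint * U a * W := by
  have h1 : W.adjoint * W = 1 := Unitary.star_mul_self_of_mem hW
  have h2 : W * W.adjoint = 1 := Unitary.mul_star_self_of_mem hW
  have h1' (z : G) : W.adjoint (W z) = z := congrArg (fun S : G →L[ℂ] G => S z) h1
  have hc (a : ℝ) : W * (W.adjoint * U a * W) = U a * W := by
    rw [← mul_assoc, ← mul_assoc, h2, one_mul]
  have hc' (a : ℝ) : W.adjoint * U a = W.adjoint * U a * W * W.adjoint := by
    rw [mul_assoc _ W, h2, mul_one]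
  refine LinearPMap.eq_of_eq_graph (SetLike.ext fun p => ?_)
  obtain ⟨z, w⟩ := p
  rw [graph_generator, LinearPMap.mem_graph_iff]
  constructor
  · rintro ⟨y, rfl, rfl⟩
    have hy : (W y, generator U ⟨W y, y.2⟩) ∈ generatorGraph U := by
      rw [← graph_generator]
      exact (generator U).mem_graph ⟨W y, y.2⟩
    have := W.adjoint.map_mem_generatorGraph hc' hy
    rwa [h1'] at this
  · intro h
    have h3 := W.map_mem_generatorGraph hc h
    rw [← graph_generator, LinearPMap.mem_graph_iff] at h3
    obtain ⟨y, hy, hyw⟩ := h3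
    dsimp only at hy hyw
    refine ⟨⟨z, ?_⟩, rfl, ?_⟩
    · change W z ∈ (generator U).domain
      rw [← hy]
      exact y.2
    · change W.adjoint (generator U ⟨W z, _⟩) = w
      rw [show (⟨W z, _⟩ : (generator U).domain) = y from Subtype.ext hy.symm, hyw, h1']

end Generator

/-! ### The Weyl relations of an equilibrium system -/

theorem CommutingTuple.inner_integral_of_op_eq_zero {n : ℕ} {H : Type*} [NormedAddCommGroup H]
    [InnerProductSpace ℂ H] [CompleteSpace H] {A : CommutingTuple n H} {Ω : H}
    (hΩ : ∀ μ, ∃ h : Ω ∈ (A.op μ).domain, A.op μ ⟨Ω, h⟩ = 0) {f : (Fin n → ℝ) → ℂ}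
    (hf : BoundedMeasurable f) (ψ : H) : ⟪Ω, A.spec.integral f ψ⟫_ℂ = f 0 * ⟪Ω, ψ⟫_ℂ := by
  rw [← ContinuousLinearMap.adjoint_inner_left, A.spec.adjoint_integral hf,
    CommutingTuple.integral_apply_of_op_eq_zero hΩ hf.conj, inner_smul_left, Complex.conj_conj]

namespace EquilibriumSystem

variable {H : Type*} [NormedAddCommGroup H] [InnerProductSpace ℂ H] [CompleteSpace H]
  (S : EquilibriumSystem H)

theorem Q_apply (ψ : H) : S.Q ψ = ψ - ⟪S.Ω, ψ⟫_ℂ • S.Ω := by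
  rw [Q, Submodule.starProjection_orthogonal', sub_apply, one_apply_eq_self,
    Submodule.starProjection_unit_singleton ℂ S.norm_Ω]

theorem inner_Ω_Ω : ⟪S.Ω, S.Ω⟫_ℂ = 1 := by
  rw [inner_self_eq_norm_sq_to_K, S.norm_Ω]
  simp

theorem inner_Ω_Q (ψ : H) : ⟪S.Ω, S.Q ψ⟫_ℂ = 0 := by
  rw [Q_apply, inner_sub_right, inner_smul_right, inner_Ω_Ω, mul_one, sub_self]

theorem Q_of_inner_eq_zero {ψ : H} (h : ⟪S.Ω, ψ⟫_ℂ = 0) : S.Q ψ = ψ := by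
  rw [Q_apply, h, zero_smul, sub_zero]

theorem Q_Q (ψ : H) : S.Q (S.Q ψ) = S.Q ψ := S.Q_of_inner_eq_zero (S.inner_Ω_Q ψ)

theorem inner_Q_left (ψ χ : H) : ⟪S.Q ψ, χ⟫_ℂ = ⟪ψ, S.Q χ⟫_ℂ := by
  rw [Q_apply, Q_apply, inner_sub_left, inner_sub_right, inner_smul_left, inner_smul_right,
    inner_conj_symm, mul_comm]

theorem sub_Q_apply (ψ : H) : ψ - S.Q ψ = ⟪S.Ω, ψ⟫_ℂ • S.Ω := by
  rw [Q_apply, sub_sub_cancel]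

theorem Q_integral {A : CommutingTuple 4 H}
    (hΩ : ∀ μ, ∃ h : S.Ω ∈ (A.op μ).domain, A.op μ ⟨S.Ω, h⟩ = 0) {f : (Fin 4 → ℝ) → ℂ}
    (hf : BoundedMeasurable f) (ψ : H) :
    S.Q (A.spec.integral f ψ) = A.spec.integral f (S.Q ψ) := by
  rw [Q_apply, Q_apply, map_sub, map_smul, CommutingTuple.inner_integral_of_op_eq_zero hΩ hf,
    CommutingTuple.integral_apply_of_op_eq_zero hΩ hf, smul_smul, mul_comm]

theorem exp_X_Ω (p : Fin 4 → ℝ) : S.X.spec.exp p S.Ω = S.Ω := by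
  rw [PVM.exp_eq, CommutingTuple.integral_apply_of_op_eq_zero S.X_Ω (boundedMeasurable_phase p),
    phase_zero_right, one_smul]

theorem exp_P_Ω (a : Fin 4 → ℝ) : S.P.spec.exp a S.Ω = S.Ω := by
  rw [PVM.exp_eq, CommutingTuple.integral_apply_of_op_eq_zero S.P_Ω (boundedMeasurable_phase a),
    phase_zero_right, one_smul]

theorem inner_Ω_exp_X (p : Fin 4 → ℝ) (ψ : H) : ⟪S.Ω, S.X.spec.exp p ψ⟫_ℂ = ⟪S.Ω, ψ⟫_ℂ := by
  rw [PVM.exp_eq, CommutingTuple.inner_integral_of_op_eq_zero S.X_Ω (boundedMeasurable_phase p),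
    phase_zero_right, one_mul]

/-- Conjugation with `e^{ip·X}` multiplies `e^{ia·P}` by a phase on `(ℂΩ)^⊥` and fixes it on
`ℂΩ`. -/
theorem exp_X_exp_P_exp_X_neg (p a : Fin 4 → ℝ) (ψ : H) :
    S.X.spec.exp p (S.P.spec.exp a (S.X.spec.exp (-p) ψ)) =
      S.P.spec.exp a (ψ - S.Q ψ) + phase (-p) a • S.P.spec.exp a (S.Q ψ) := by
  conv_lhs => rw [← sub_add_cancel ψ (S.Q ψ)]
  simp only [map_add]
  congr 1
  · rw [sub_Q_apply]
    simp only [map_smul, exp_X_Ω, exp_P_Ω]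
  · rw [S.weyl p a _ ((S.inner_Ω_exp_X _ _).trans (S.inner_Ω_Q ψ)), PVM.exp_exp_neg]
    congr 1
    simp [phase]

/-- On vectors orthogonal to `Ω`, the unitary `e^{-ip·X}` translates the spectral distribution of
the Liouvillian by `-p₀`, by uniqueness of characteristic functions. -/
theorem measure_specL_exp_X_neg (p : Fin 4 → ℝ) {ψ : H} (hψ : ⟪S.Ω, ψ⟫_ℂ = 0) :
    S.specL.measure (S.X.spec.exp (-p) ψ) = (S.specL.measure ψ).map (fun t => t - p 0) := by
  have hchar (χ : H) (s : ℝ) : charFun (S.specL.measure χ) s =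
      ⟪χ, S.P.spec.exp (Pi.single 0 s) χ⟫_ℂ := by
    rw [charFun_apply_real, specL, PVM.measure_map, MeasureTheory.integral_map
      (measurable_pi_apply 0).aemeasurable (by fun_prop), PVM.exp_eq,
      S.P.spec.inner_integral (boundedMeasurable_phase _)]
    refine integral_congr_ae (.of_forall fun x => ?_)
    simp only [phase_single, Complex.ofReal_mul]
    congr 1
    ring
  refine Measure.ext_of_charFun (funext fun s => ?_)
  have h1 : charFun ((S.specL.measure ψ).map (fun t => t - p 0)) s =
      phase (-p) (Pi.single 0 s) * charFun (S.specL.measure ψ) s := by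
    rw [charFun_apply_real, charFun_apply_real,
      MeasureTheory.integral_map (by fun_prop) (by fun_prop), ← MeasureTheory.integral_const_mul]
    refine integral_congr_ae (.of_forall fun t => ?_)
    simp only [phase, ← Complex.exp_add]
    congr 1
    rw [Finset.sum_eq_single 0 (fun ν _ hν => by simp [hν]) (by simp)]
    simp only [Pi.neg_apply, Pi.single_eq_same]
    push_cast
    ring
  rw [h1, hchar, hchar, ← inner_smul_right, ← neg_neg (-p), ← PVM.adjoint_exp,
    ContinuousLinearMap.adjoint_inner_left, PVM.adjoint_exp, neg_neg,
    exp_X_exp_P_exp_X_neg, S.Q_of_inner_eq_zero hψ, sub_self, map_zero, zero_add]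

theorem specL_integral {f : ℝ → ℂ} (hf : BoundedMeasurable f) :
    S.specL.integral f = S.P.spec.integral fun x => f (x 0) :=
  S.P.spec.integral_map (measurable_pi_apply 0) hf

theorem specL_integral_Q {f : ℝ → ℂ} (hf : BoundedMeasurable f) (ψ : H) :
    S.Q (S.specL.integral f ψ) = S.specL.integral f (S.Q ψ) := by
  rw [S.specL_integral hf, S.Q_integral S.P_Ω (hf.comp (measurable_pi_apply 0))]

/-- The expectation in `e^{-ip·X} ψ` of a function of the Liouvillian vanishing on `ℂΩ`. -/
theorem inner_specL_integral_exp_X_neg {f : ℝ → ℂ} (hf : BoundedMeasurable f) (hf0 : f 0 = 0)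
    (p : Fin 4 → ℝ) (ψ : H) :
    ⟪S.X.spec.exp (-p) ψ, S.specL.integral f (S.X.spec.exp (-p) ψ)⟫_ℂ =
      ∫ t, f (t - p 0) ∂S.specL.measure (S.Q ψ) := by
  -- As `f 0 = 0`, the operator `f(L)` vanishes on `Ω`.
  have hQ (χ : H) : S.specL.integral f χ = S.Q (S.specL.integral f (S.Q χ)) := by
    rw [S.specL_integral_Q hf, Q_Q]
    conv_lhs => rw [← sub_add_cancel χ (S.Q χ)]
    rw [map_add, sub_Q_apply, map_smul, S.specL_integral hf,
      CommutingTuple.integral_apply_of_op_eq_zero S.P_Ω (hf.comp (measurable_pi_apply 0)),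
      Pi.zero_apply, hf0, zero_smul, smul_zero, zero_add]
  have hm : Measurable fun t => t - p 0 := by fun_prop
  rw [hQ, ← S.inner_Q_left, PVM.exp_eq, S.Q_integral S.X_Ω (boundedMeasurable_phase _),
    ← PVM.exp_eq, S.specL.inner_integral hf, S.measure_specL_exp_X_neg p (S.inner_Ω_Q ψ),
    MeasureTheory.integral_map hm.aemeasurable hf.measurable.aestronglyMeasurable]

end EquilibriumSystem

/-! ### Operators on the Hilbert space tensor product -/

section Tensor

variable {H K : Type*} [NormedAddCommGroup H] [InnerProductSpace ℂ H]
  [NormedAddCommGroup K] [InnerProductSpace ℂ K]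

theorem inner_elem_elem (ψ ψ' : H) (η η' : K) :
    ⟪elem ψ η, elem ψ' η'⟫_ℂ = ⟪ψ, ψ'⟫_ℂ * ⟪η, η'⟫_ℂ := by
  rw [elem, elem, UniformSpace.Completion.inner_coe, TensorProduct.inner_tmul]

/-- The elementary tensor as a continuous bilinear map. -/
noncomputable def elemL (H K : Type*) [NormedAddCommGroup H] [InnerProductSpace ℂ H]
    [NormedAddCommGroup K] [InnerProductSpace ℂ K] : H →L[ℂ] K →L[ℂ] HilbertTensor H K :=
  (ContinuousLinearMap.compL ℂ K (H ⊗[ℂ] K) (HilbertTensor H K)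
    UniformSpace.Completion.toComplL) ∘L TensorProduct.mkL ℂ H K

theorem elemL_apply (ψ : H) (η : K) : elemL H K ψ η = elem ψ η := rfl

theorem insertRight_apply (ψ : H) (η : K) : insertRight H η ψ = elem ψ η := rfl

theorem norm_insertRight_le (η : K) : ‖insertRight H η‖ ≤ ‖η‖ := by
  refine ContinuousLinearMap.opNorm_le_bound _ (norm_nonneg _) fun ψ => ?_
  rw [insertRight_apply, elem, UniformSpace.Completion.norm_coe, TensorProduct.norm_tmul, mul_comm]

/-- The elementary tensors span a dense subspace. -/
theorem HilbertTensor.mem_of_elem_mem {D : Submodule ℂ (HilbertTensor H K)}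
    (hD : IsClosed (D : Set (HilbertTensor H K))) (h : ∀ ψ η, elem ψ η ∈ D)
    (z : HilbertTensor H K) : z ∈ D := by
  refine UniformSpace.Completion.induction_on (p := fun z => z ∈ D) z hD fun x => ?_
  induction x using TensorProduct.induction_on with
  | zero => rw [UniformSpace.Completion.coe_zero]; exact D.zero_mem
  | tmul ψ η => exact h ψ η
  | add x y hx hy => rw [UniformSpace.Completion.coe_add]; exact D.add_mem hx hy

theorem ContinuousLinearMap.ext_elem {G : Type*} [NormedAddCommGroup G] [NormedSpace ℂ G]
    {A B : HilbertTensor H K →L[ℂ] G} (h : ∀ ψ η, A (elem ψ η) = B (elem ψ η)) : A = B := by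
  ext z
  have hcl : IsClosed (LinearMap.ker ((A - B : HilbertTensor H K →L[ℂ] G) :
      HilbertTensor H K →ₗ[ℂ] G) : Set (HilbertTensor H K)) := (A - B).isClosed_ker
  have := HilbertTensor.mem_of_elem_mem hcl (fun ψ η => by simp [h]) z
  simpa [sub_eq_zero] using this

/-- A bounded operator on the tensor product is determined by its quadratic form on elementary
tensors, by polarization in each of the two factors. -/
theorem ContinuousLinearMap.ext_inner_elem [CompleteSpace H] [CompleteSpace K]
    {A B : HilbertTensor H K →L[ℂ] HilbertTensor H K}
    (h : ∀ ψ η, ⟪elem ψ η, A (elem ψ η)⟫_ℂ = ⟪elem ψ η, B (elem ψ η)⟫_ℂ) : A = B := by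
  have h1 (η : K) : (insertRight H η).adjoint ∘L A ∘L insertRight H η =
      (insertRight H η).adjoint ∘L B ∘L insertRight H η :=
    ContinuousLinearMap.ext_inner_self fun ψ => by
      simpa [ContinuousLinearMap.adjoint_inner_right, insertRight_apply] using h ψ η
  have h2 (ψ ψ' : H) (η : K) : ⟪elem ψ' η, A (elem ψ η)⟫_ℂ = ⟪elem ψ' η, B (elem ψ η)⟫_ℂ := by
    have := congrArg (fun T : H →L[ℂ] H => ⟪ψ', T ψ⟫_ℂ) (h1 η)
    simpa [ContinuousLinearMap.adjoint_inner_right, insertRight_apply] using this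
  have h3 (ψ ψ' : H) : (elemL H K ψ').adjoint ∘L A ∘L elemL H K ψ =
      (elemL H K ψ').adjoint ∘L B ∘L elemL H K ψ :=
    ContinuousLinearMap.ext_inner_self fun η => by
      simpa [ContinuousLinearMap.adjoint_inner_right, elemL_apply] using h2 ψ ψ' η
  have h4 (ψ ψ' : H) (η η' : K) :
      ⟪elem ψ' η', A (elem ψ η)⟫_ℂ = ⟪elem ψ' η', B (elem ψ η)⟫_ℂ := by
    have := congrArg (fun T : K →L[ℂ] K => ⟪η', T η⟫_ℂ) (h3 ψ ψ')
    simpa [ContinuousLinearMap.adjoint_inner_right, elemL_apply] using this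
  refine ContinuousLinearMap.ext_elem fun ψ η => ?_
  have h5 : innerSL ℂ (A (elem ψ η)) = innerSL ℂ (B (elem ψ η)) :=
    ContinuousLinearMap.ext_elem fun ψ' η' => by
      simp only [innerSL_apply_apply]
      rw [← inner_conj_symm, h4, inner_conj_symm]
  exact ext_inner_right ℂ fun v => congrArg (fun T : HilbertTensor H K →L[ℂ] ℂ => T v) h5

/-- The bounded operator `A ⊗ B`. -/
noncomputable def opTensor (A : H →L[ℂ] H) (B : K →L[ℂ] K) :
    HilbertTensor H K →L[ℂ] HilbertTensor H K :=
  (TensorProduct.mapL A B).completion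

theorem opTensor_elem (A : H →L[ℂ] H) (B : K →L[ℂ] K) (ψ : H) (η : K) :
    opTensor A B (elem ψ η) = elem (A ψ) (B η) := by
  rw [opTensor, elem, ContinuousLinearMap.completion_apply_coe, TensorProduct.mapL_tmul, elem]

theorem tensorOne_elem (A : H →L[ℂ] H) (ψ : H) (η : K) :
    tensorOne K A (elem ψ η) = elem (A ψ) η := by
  rw [tensorOne, elem, ContinuousLinearMap.completion_apply_coe,
    ContinuousLinearMap.rTensor_tmul, elem]

theorem tensorOne_eq_opTensor (A : H →L[ℂ] H) : tensorOne K A = opTensor A 1 :=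
  ContinuousLinearMap.ext_elem fun ψ η => by
    rw [tensorOne_elem, opTensor_elem, one_apply_eq_self]

theorem opTensor_one_one : opTensor (1 : H →L[ℂ] H) (1 : K →L[ℂ] K) = 1 :=
  ContinuousLinearMap.ext_elem fun ψ η => by simp [opTensor_elem]

theorem opTensor_mul (A A' : H →L[ℂ] H) (B B' : K →L[ℂ] K) :
    opTensor (A * A') (B * B') = opTensor A B * opTensor A' B' :=
  ContinuousLinearMap.ext_elem fun ψ η => by simp [opTensor_elem]

theorem elem_add_left (ψ ψ' : H) (η : K) : elem (ψ + ψ') η = elem ψ η + elem ψ' η := by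
  rw [← elemL_apply, map_add]; rfl

/-- The convergence of isometries needs to be checked on elementary tensors only. -/
theorem exists_tendsto_of_elem {D : ℕ → HilbertTensor H K →L[ℂ] HilbertTensor H K}
    (hD : ∀ n z, ‖D n z‖ = ‖z‖) (h : ∀ ψ η, CauchySeq fun n => D n (elem ψ η)) :
    ∃ W : HilbertTensor H K →L[ℂ] HilbertTensor H K,
      ∀ z, Tendsto (fun n => D n z) atTop (𝓝 (W z)) := by
  let V : Submodule ℂ (HilbertTensor H K) :=
    { carrier := {z | CauchySeq fun n => D n z}
      add_mem' := fun {z w} hz hw => by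
        have : CauchySeq fun n => D n z + D n w := CauchySeq.add hz hw
        simpa using this
      zero_mem' := by simpa using cauchySeq_const (0 : HilbertTensor H K)
      smul_mem' := fun c z hz => by
        have : CauchySeq fun n => c • D n z :=
          (uniformContinuous_const_smul c).comp_cauchySeq hz
        simpa using this }
  have hV : IsClosed (V : Set (HilbertTensor H K)) := by
    refine isClosed_of_closure_subset fun z hz => ?_
    change CauchySeq fun n => D n z
    rw [Metric.cauchySeq_iff']
    intro ε hε
    obtain ⟨w, hw, hzw⟩ := Metric.mem_closure_iff.1 hz (ε / 3) (by positivity)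
    obtain ⟨N, hN⟩ := Metric.cauchySeq_iff'.1 (show CauchySeq fun n => D n w from hw) (ε / 3)
      (by positivity)
    refine ⟨N, fun n hn => ?_⟩
    have hd (n : ℕ) : dist (D n z) (D n w) = dist z w := by
      rw [dist_eq_norm, ← map_sub, hD, dist_eq_norm]
    have h1 := dist_triangle4 (D n z) (D n w) (D N w) (D N z)
    rw [hd, dist_comm (D N w), hd] at h1
    linarith [hN n hn]
  have hex (z : HilbertTensor H K) : ∃ w, Tendsto (fun n => D n z) atTop (𝓝 w) :=
    cauchySeq_tendsto_of_complete (HilbertTensor.mem_of_elem_mem hV h z)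
  choose f hf using hex
  exact ⟨continuousLinearMapOfTendsto D (tendsto_pi_nhds.2 hf), hf⟩

variable [CompleteSpace K]

/-! ### Integrals of operators on one factor against a spectral measure on the other -/

variable {β : Type*} [MeasurableSpace β]

/-- The operator `∑_b A_b ⊗ F(g⁻¹ b)`, i.e. the integral `∫ A(g(y)) ⊗ dF(y)` for a simple
function `g`. -/
noncomputable def simpleFiber (F : PVM β K) (A : β → H →L[ℂ] H) (g : SimpleFunc β β) :
    HilbertTensor H K →L[ℂ] HilbertTensor H K :=
  ∑ b ∈ g.range, opTensor (A b) (F.proj (g ⁻¹' {b}))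

theorem inner_simpleFiber (F : PVM β K) (A : β → H →L[ℂ] H) (g : SimpleFunc β β) (ψ : H) (η : K) :
    ⟪elem ψ η, simpleFiber F A g (elem ψ η)⟫_ℂ = ∫ y, ⟪ψ, A (g y) ψ⟫_ℂ ∂F.measure η := by
  rw [integral_comp_simpleFunc (F.measure η) g fun b => ⟪ψ, A b ψ⟫_ℂ]
  simp only [simpleFiber, sum_apply, inner_sum, opTensor_elem, inner_elem_elem,
    F.inner_proj_self η (g.measurableSet_fiber _)]
  exact Finset.sum_congr rfl fun b _ => mul_comm _ _

theorem inner_simpleFiber_simpleFiber (F : PVM β K) (A : β → H →L[ℂ] H) (T : H →L[ℂ] H)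
    (g h : SimpleFunc β β) (ψ : H) (η : K) :
    ⟪simpleFiber F A g (elem ψ η), tensorOne K T (simpleFiber F A h (elem ψ η))⟫_ℂ =
      ∫ y, ⟪A (g y) ψ, T (A (h y) ψ)⟫_ℂ ∂F.measure η := by
  rw [integral_comp_simpleFunc₂ (F.measure η) g h fun b c => ⟪A b ψ, T (A c ψ)⟫_ℂ]
  simp only [simpleFiber, sum_apply, map_sum, inner_sum, sum_inner, opTensor_elem, tensorOne_elem,
    inner_elem_elem, F.inner_proj_proj η (g.measurableSet_fiber _) (h.measurableSet_fiber _)]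
  rw [Finset.sum_comm]
  exact Finset.sum_congr rfl fun b _ => Finset.sum_congr rfl fun c _ => mul_comm _ _

variable [CompleteSpace H]

/-- An integral of isometries against a spectral measure is an isometry: take `T = 1` in the formula
for the matrix elements of the conjugates of `T ⊗ 1`. -/
theorem adjoint_mul_self_of_fiber {W : HilbertTensor H K →L[ℂ] HilbertTensor H K}
    {F : PVM β K} {A : β → H →L[ℂ] H}
    (hA : ∀ y ψ, ‖A y ψ‖ = ‖ψ‖)
    (hW : ∀ (T : H →L[ℂ] H) ψ η, ⟪W (elem ψ η), tensorOne K T (W (elem ψ η))⟫_ℂ =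
      ∫ y, ⟪A y ψ, T (A y ψ)⟫_ℂ ∂F.measure η) : W.adjoint * W = 1 := by
  refine ContinuousLinearMap.ext_inner_elem fun ψ η => ?_
  have h := hW 1 ψ η
  rw [tensorOne_eq_opTensor, opTensor_one_one] at h
  simp only [one_apply_eq_self, inner_self_eq_norm_sq_to_K, hA] at h
  rw [mul_apply_eq_comp, ContinuousLinearMap.adjoint_inner_right, inner_self_eq_norm_sq_to_K,
    h, one_apply_eq_self, inner_elem_elem, MeasureTheory.integral_const, F.measureReal_univ,
    inner_self_eq_norm_sq_to_K, inner_self_eq_norm_sq_to_K, Complex.real_smul, mul_comm]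
  simp

/-- The integral `∫ A(y) ⊗ dF(y)` of a strongly continuous family of isometries exists, as a
strong limit of the integrals of simple functions.  Its matrix elements, and those of the
conjugates of `T ⊗ 1` with it, are computed fibrewise. -/
theorem exists_fiberIntegral [PseudoEMetricSpace β] [SecondCountableTopology β]
    [OpensMeasurableSpace β] [Nonempty β] (F : PVM β K)
    (A : β → H →L[ℂ] H) (hA : ∀ ψ, Continuous fun y => A y ψ) (hA' : ∀ y ψ, ‖A y ψ‖ = ‖ψ‖) :
    ∃ W : HilbertTensor H K →L[ℂ] HilbertTensor H K,
      (∀ ψ η, ⟪elem ψ η, W (elem ψ η)⟫_ℂ = ∫ y, ⟪ψ, A y ψ⟫_ℂ ∂F.measure η) ∧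
      ∀ (T : H →L[ℂ] H) ψ η, ⟪W (elem ψ η), tensorOne K T (W (elem ψ η))⟫_ℂ =
        ∫ y, ⟪A y ψ, T (A y ψ)⟫_ℂ ∂F.measure η := by
  obtain ⟨g, hg⟩ : ∃ g : ℕ → SimpleFunc β β, ∀ y, Tendsto (fun n => g n y) atTop (𝓝 y) :=
    ⟨SimpleFunc.approxOn id measurable_id Set.univ (Classical.arbitrary β)
      (Set.mem_univ _),
      fun y => SimpleFunc.tendsto_approxOn measurable_id (Set.mem_univ _) (by simp)⟩
  have hsm (n : ℕ) (ψ : H) : StronglyMeasurable fun y => A (g n y) ψ :=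
    ((g n).map fun b => A b ψ).stronglyMeasurable
  have hlim (ψ : H) (y : β) : Tendsto (fun n => A (g n y) ψ) atTop (𝓝 (A y ψ)) :=
    ((hA ψ).tendsto y).comp (hg y)
  have hiso (n : ℕ) (z : HilbertTensor H K) : ‖simpleFiber F A (g n) z‖ = ‖z‖ :=
    ((simpleFiber F A (g n)).norm_map_iff_adjoint_comp_self).2 (adjoint_mul_self_of_fiber
      (fun y ψ => hA' (g n y) ψ)
      fun T ψ η => inner_simpleFiber_simpleFiber F A T (g n) (g n) ψ η) z
  obtain ⟨W, hW⟩ := exists_tendsto_of_elem hiso fun ψ η =>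
    cauchySeq_of_inner_eq_integral (F := fun _ => ‖ψ‖) (integrable_const _)
      (fun n => hsm n ψ) (fun n y => (hA' _ ψ).le) (hlim ψ) fun n m => by
        have h2 := inner_simpleFiber_simpleFiber F A 1 (g n) (g m) ψ η
        rw [tensorOne_eq_opTensor, opTensor_one_one] at h2
        exact h2
  refine ⟨W, fun ψ η => ?_, fun T ψ η => ?_⟩
  · refine tendsto_nhds_unique (tendsto_const_nhds.inner (hW _)) ?_
    simp_rw [inner_simpleFiber]
    refine tendsto_integral_of_dominated_convergence (fun _ => ‖ψ‖ * ‖ψ‖)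
      (fun n => (stronglyMeasurable_const.inner (hsm n ψ)).aestronglyMeasurable)
      (integrable_const _) (fun n => .of_forall fun y => ?_)
      (.of_forall fun y => tendsto_const_nhds.inner (hlim ψ y))
    exact (norm_inner_le_norm _ _).trans (by rw [hA'])
  · refine tendsto_nhds_unique
      ((hW _).inner (((tensorOne K T).continuous.tendsto _).comp (hW _))) ?_
    simp only [Function.comp_apply, inner_simpleFiber_simpleFiber]
    refine tendsto_integral_of_dominated_convergence (fun _ => ‖ψ‖ * (‖T‖ * ‖ψ‖))
      (fun n => ((hsm n ψ).inner
        (T.continuous.comp_stronglyMeasurable (hsm n ψ))).aestronglyMeasurable)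
      (integrable_const _) (fun n => .of_forall fun y => ?_)
      (.of_forall fun y => (hlim ψ y).inner ((T.continuous.tendsto _).comp (hlim ψ y)))
    refine (norm_inner_le_norm _ _).trans ?_
    rw [hA']
    exact mul_le_mul_of_nonneg_left ((T.le_opNorm _).trans (by rw [hA'])) (norm_nonneg _)

end Tensor

/-! ### The interaction unitary -/

section Interaction

variable {m n : ℕ} {H K : Type*} [NormedAddCommGroup H] [InnerProductSpace ℂ H] [CompleteSpace H]
  [NormedAddCommGroup K] [InnerProductSpace ℂ K] [CompleteSpace K]

theorem phase_neg_mulVec (M : Matrix (Fin m) (Fin n) ℝ) (x : Fin m → ℝ) (y : Fin n → ℝ) :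
    phase (-(M.mulVec y)) x =
      Complex.exp (-Complex.I * ((∑ μ, ∑ ν, M μ ν * x μ * y ν : ℝ) : ℂ)) := by
  have h : ∑ μ, (-(M.mulVec y)) μ * x μ = -∑ μ, ∑ ν, M μ ν * x μ * y ν := by
    rw [← Finset.sum_neg_distrib]
    refine Finset.sum_congr rfl fun μ _ => ?_
    rw [Pi.neg_apply, Matrix.mulVec, dotProduct, neg_mul, Finset.sum_mul]
    exact congrArg _ (Finset.sum_congr rfl fun ν _ => by ring)
  rw [phase, h, Complex.ofReal_neg, mul_neg, neg_mul]

/-- The interaction is the integral `∫ e^{-i(My)·X} ⊗ dE^Y(y)`.  It is unitary, because its adjoint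
is the integral of the adjoint family. -/
theorem interaction_spec (M : Matrix (Fin m) (Fin n) ℝ) (X : CommutingTuple m H)
    (Y : CommutingTuple n K) :
    interaction M X Y ∈ unitary (HilbertTensor H K →L[ℂ] HilbertTensor H K) ∧
      ∀ (T : H →L[ℂ] H) ψ η,
        ⟪interaction M X Y (elem ψ η), tensorOne K T (interaction M X Y (elem ψ η))⟫_ℂ =
          ∫ y, ⟪X.spec.exp (-(M.mulVec y)) ψ, T (X.spec.exp (-(M.mulVec y)) ψ)⟫_ℂ
            ∂Y.spec.measure η := by
  have hc : Continuous fun y : Fin n → ℝ => M.mulVec y :=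
    Continuous.matrix_mulVec continuous_const continuous_id
  obtain ⟨W, hW1, hW2⟩ := exists_fiberIntegral Y.spec (fun y => X.spec.exp (-(M.mulVec y)))
    (fun ψ => (X.spec.continuous_exp_apply ψ).comp hc.neg) fun y ψ => X.spec.norm_exp_apply _ ψ
  obtain ⟨V, hV1, hV2⟩ := exists_fiberIntegral Y.spec (fun y => X.spec.exp (M.mulVec y))
    (fun ψ => (X.spec.continuous_exp_apply ψ).comp hc) fun y ψ => X.spec.norm_exp_apply _ ψ
  -- `V` is the integral of the adjoint family, so that `W` is unitary and not only isometric.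
  have hVW : V = W.adjoint := by
    refine ContinuousLinearMap.ext_inner_elem fun ψ η => ?_
    rw [ContinuousLinearMap.adjoint_inner_right, ← inner_conj_symm (W _), hW1, hV1, ← integral_conj]
    refine integral_congr_ae (.of_forall fun y => ?_)
    change ⟪ψ, X.spec.exp (M.mulVec y) ψ⟫_ℂ =
      (starRingEnd ℂ) ⟪ψ, X.spec.exp (-(M.mulVec y)) ψ⟫_ℂ
    rw [inner_conj_symm, ← X.spec.adjoint_exp, ContinuousLinearMap.adjoint_inner_left]
  have hWu : W ∈ unitary (HilbertTensor H K →L[ℂ] HilbertTensor H K) := by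
    rw [Unitary.mem_iff]
    constructor
    · exact adjoint_mul_self_of_fiber (fun y ψ => X.spec.norm_exp_apply _ ψ) hW2
    · have h := adjoint_mul_self_of_fiber (fun y ψ => X.spec.norm_exp_apply _ ψ) hV2
      rwa [hVW, ContinuousLinearMap.adjoint_adjoint] at h
  have hform (ψ : H) (η : K) : ⟪elem ψ η, W (elem ψ η)⟫_ℂ =
      ∫ x, ∫ y, Complex.exp (-Complex.I * ((∑ μ, ∑ ν, M μ ν * x μ * y ν : ℝ) : ℂ))
        ∂Y.spec.measure η ∂X.spec.measure ψ := by
    have hint : Integrable (Function.uncurry fun (x : Fin m → ℝ) (y : Fin n → ℝ) =>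
        phase (-(M.mulVec y)) x) ((X.spec.measure ψ).prod (Y.spec.measure η)) := by
      have hcont : Continuous (Function.uncurry fun (x : Fin m → ℝ) (y : Fin n → ℝ) =>
          phase (-(M.mulVec y)) x) :=
        continuous_phase.comp ((hc.comp continuous_snd).neg.prodMk continuous_fst)
      exact .of_bound hcont.aestronglyMeasurable 1 (.of_forall fun z => (norm_phase _ _).le)
    simp_rw [← phase_neg_mulVec]
    rw [MeasureTheory.integral_integral_swap hint, hW1]
    refine integral_congr_ae (.of_forall fun y => ?_)
    change ⟪ψ, X.spec.exp (-(M.mulVec y)) ψ⟫_ℂ = _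
    rw [PVM.exp_eq, X.spec.inner_integral (boundedMeasurable_phase _)]
  have hI : interaction M X Y = W := by
    have hx : ∃ W : HilbertTensor H K →L[ℂ] HilbertTensor H K, ∀ (ψ : H) (η : K),
        ⟪elem ψ η, W (elem ψ η)⟫_ℂ =
          ∫ x, ∫ y, Complex.exp (-Complex.I * ((∑ μ, ∑ ν, M μ ν * x μ * y ν : ℝ) : ℂ))
            ∂Y.spec.measure η ∂X.spec.measure ψ := ⟨W, hform⟩
    rw [interaction, dif_pos hx]
    exact ContinuousLinearMap.ext_inner_elem fun ψ η => by rw [hx.choose_spec, hform]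
  rw [hI]
  exact ⟨hWu, hW2⟩

end Interaction

/-! ### The deformed Liouvillian -/

section Liouvillian

variable {H K : Type*} [NormedAddCommGroup H] [InnerProductSpace ℂ H]
  [NormedAddCommGroup K] [InnerProductSpace ℂ K]

theorem mem_graph_strongLimit {R : ℝ → H →L[ℂ] H} {z w : H} :
    (z, w) ∈ (strongLimit R).graph ↔ Tendsto (fun r => R r z) atTop (𝓝 w) := by
  rw [strongLimit, Submodule.toLinearPMap_graph_eq]
  · rfl
  · rintro ⟨x, y⟩ hx hx'
    change Tendsto (fun r => R r x) atTop (𝓝 y) at hx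
    change x = 0 at hx'
    subst hx'
    simpa using tendsto_nhds_unique hx (by simp)

variable [CompleteSpace H]

theorem NormalState.inner_slice (φ : NormalState K)
    (A : HilbertTensor H K →L[ℂ] HilbertTensor H K) (ψ : H) :
    HasSum (fun j => ⟪elem ψ (φ.vec j), A (elem ψ (φ.vec j))⟫_ℂ) ⟪ψ, φ.slice A ψ⟫_ℂ := by
  have hs : Summable fun j =>
      (insertRight H (φ.vec j)).adjoint ∘L A ∘L insertRight H (φ.vec j) := by
    refine .of_norm_bounded (φ.hasSum_vec.summable.mul_left ‖A‖) fun j => ?_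
    refine (ContinuousLinearMap.opNorm_comp_le _ _).trans ?_
    have h1 := norm_insertRight_le (H := H) (φ.vec j)
    rw [LinearIsometryEquiv.norm_map]
    calc ‖insertRight H (φ.vec j)‖ * ‖A ∘L insertRight H (φ.vec j)‖
        ≤ ‖φ.vec j‖ * (‖A‖ * ‖φ.vec j‖) := by
          gcongr
          exact (ContinuousLinearMap.opNorm_comp_le _ _).trans (by gcongr)
      _ = ‖A‖ * ‖φ.vec j‖ ^ 2 := by ring
  have h2 := (hs.hasSum.mapL (ContinuousLinearMap.apply ℂ H ψ)).mapL (innerSL ℂ ψ)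
  simpa [slice, ContinuousLinearMap.adjoint_inner_right, insertRight_apply] using h2

variable [CompleteSpace K]

namespace NormalState

variable (φ : NormalState K)

variable {α : Type*} [MeasurableSpace α] (E : PVM α K)

instance : IsProbabilityMeasure (φ.distribution E) := by
  constructor
  rw [distribution, Measure.sum_apply _ MeasurableSet.univ]
  have h (j : ℕ) : E.measure (φ.vec j) Set.univ = ENNReal.ofReal (‖φ.vec j‖ ^ 2) := by
    rw [← E.measureReal_univ, measureReal_def, ENNReal.ofReal_toReal (measure_ne_top _ _)]
  simp_rw [h]
  rw [← ENNReal.ofReal_tsum_of_nonneg (fun j => sq_nonneg _) φ.hasSum_vec.summable,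
    φ.hasSum_vec.tsum_eq, ENNReal.ofReal_one]

theorem distribution_map {β : Type*} [MeasurableSpace β] {g : α → β} (hg : Measurable g) :
    φ.distribution (E.map g hg) = (φ.distribution E).map g := by
  simp only [distribution, PVM.measure_map, Measure.map_sum hg.aemeasurable]

end NormalState

open EquilibriumSystem in
/-- The deformation of a function `f(L)` of the Liouvillian is obtained by averaging the translates
of `f`: fibrewise, the interaction unitary translates the Liouvillian. -/
theorem slice_conj_specL_integral (S : EquilibriumSystem H) {n : ℕ} (Y : CommutingTuple n K)
    (M : Matrix (Fin 4) (Fin n) ℝ) (φ : NormalState K) {f : ℝ → ℂ} (hf : BoundedMeasurable f)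
    (hf0 : f 0 = 0) :
    φ.slice ((interaction M S.X Y).adjoint ∘L tensorOne K (S.specL.integral f) ∘L
        interaction M S.X Y) =
      S.specL.integral (fun t => ∫ y, f (t - M.mulVec y 0) ∂φ.distribution Y.spec) ∘L S.Q := by
  obtain ⟨C, hC⟩ := hf.bounded
  have hm : Measurable (Function.uncurry fun (t : ℝ) (y : Fin n → ℝ) => f (t - M.mulVec y 0)) := by
    have hc : Continuous fun z : ℝ × (Fin n → ℝ) => z.1 - M.mulVec z.2 0 :=
      continuous_fst.sub ((continuous_apply 0).comp
        (Continuous.matrix_mulVec continuous_const continuous_snd))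
    exact hf.measurable.comp hc.measurable
  have hG : BoundedMeasurable fun t => ∫ y, f (t - M.mulVec y 0) ∂φ.distribution Y.spec := by
    refine ⟨hm.stronglyMeasurable.integral_prod_right.measurable, C, fun t => ?_⟩
    refine (norm_integral_le_of_norm_le_const (.of_forall fun y => hC _)).trans ?_
    rw [probReal_univ, mul_one]
  refine ContinuousLinearMap.ext_inner_self fun ψ => ?_
  have hint : Integrable (Function.uncurry fun (t : ℝ) (y : Fin n → ℝ) => f (t - M.mulVec y 0))
      ((S.specL.measure (S.Q ψ)).prod (φ.distribution Y.spec)) :=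
    .of_bound hm.aestronglyMeasurable C (.of_forall fun z => hC _)
  have h1 : HasSum (fun j => ∫ y, ∫ t, f (t - M.mulVec y 0) ∂S.specL.measure (S.Q ψ)
      ∂Y.spec.measure (φ.vec j)) (∫ y, ∫ t, f (t - M.mulVec y 0) ∂S.specL.measure (S.Q ψ)
        ∂φ.distribution Y.spec) :=
    hasSum_integral_measure hint.integral_prod_right
  have h2 := φ.inner_slice ((interaction M S.X Y).adjoint ∘L
    tensorOne K (S.specL.integral f) ∘L interaction M S.X Y) ψ
  simp only [ContinuousLinearMap.comp_apply, ContinuousLinearMap.adjoint_inner_right,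
    (interaction_spec M S.X Y).2, S.inner_specL_integral_exp_X_neg hf hf0] at h2
  rw [h2.unique h1, ← MeasureTheory.integral_integral_swap hint, ContinuousLinearMap.comp_apply,
    ← S.Q_Q, ← S.specL_integral_Q hG, ← S.inner_Q_left, S.specL.inner_integral hG, Q_Q]

namespace EquilibriumSystem

variable (S : EquilibriumSystem H)

theorem Q_mem_domain_iff (ψ : H) : S.Q ψ ∈ S.L.domain ↔ ψ ∈ S.L.domain := by
  obtain ⟨h, _⟩ := S.P_Ω 0
  rw [Q_apply]
  exact Submodule.sub_mem_iff_left _ (Submodule.smul_mem _ _ h)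

theorem L_Q_apply (ψ : S.L.domain) :
    S.L ⟨S.Q ψ, (S.Q_mem_domain_iff ψ).2 ψ.2⟩ = S.L ψ := by
  obtain ⟨h, h0⟩ := S.P_Ω 0
  have h0' : S.L ⟨S.Ω, h⟩ = 0 := h0
  have h1 : (⟨S.Q ψ, (S.Q_mem_domain_iff ψ).2 ψ.2⟩ : S.L.domain) =
      ψ - ⟪S.Ω, (ψ : H)⟫_ℂ • ⟨S.Ω, h⟩ := Subtype.ext (S.Q_apply ψ)
  rw [h1, LinearPMap.map_sub, LinearPMap.map_smul, h0', smul_zero, sub_zero]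

end EquilibriumSystem

section Averaging

variable {α : Type*} [MeasurableSpace α] {ν : Measure α} [IsProbabilityMeasure ν] {c : α → ℝ}

theorem boundedMeasurable_integral_cutoffId (hc : Measurable c) (R : ℝ) :
    BoundedMeasurable fun t => ∫ y, cutoffId R (t + c y) ∂ν := by
  refine ⟨?_, |R|, fun t => ?_⟩
  · have hm : Measurable (Function.uncurry fun (t : ℝ) (y : α) => cutoffId R (t + c y)) :=
      (measurable_cutoffId R).comp (measurable_fst.add (hc.comp measurable_snd))
    exact hm.stronglyMeasurable.integral_prod_right.measurable
  · refine (norm_integral_le_of_norm_le_const (.of_forall fun y => norm_cutoffId_le _ _)).trans ?_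
    rw [probReal_univ, mul_one]

theorem norm_integral_cutoffId_le (hc : Integrable c ν) (R t : ℝ) :
    ‖∫ y, cutoffId R (t + c y) ∂ν‖ ≤ |t| + ∫ y, |c y| ∂ν := by
  have hi : Integrable (fun y => |t| + |c y|) ν := (integrable_const _).add hc.abs
  refine (norm_integral_le_of_norm_le hi (.of_forall fun y =>
    (norm_cutoffId_le_abs _ _).trans (abs_add_le _ _))).trans_eq ?_
  rw [integral_add (integrable_const _) hc.abs, MeasureTheory.integral_const, probReal_univ,
    one_smul]

theorem tendsto_integral_cutoffId (hcm : Measurable c) (hc : Integrable c ν) (t : ℝ) :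
    Tendsto (fun R => ∫ y, cutoffId R (t + c y) ∂ν) atTop
      (𝓝 ((t : ℂ) + ((∫ y, c y ∂ν : ℝ) : ℂ))) := by
  have h : (t : ℂ) + ((∫ y, c y ∂ν : ℝ) : ℂ) = ∫ y, ((t + c y : ℝ) : ℂ) ∂ν := by
    rw [integral_complex_ofReal, integral_add (integrable_const _) hc,
      MeasureTheory.integral_const, probReal_univ, one_smul, Complex.ofReal_add]
  rw [h]
  refine tendsto_integral_filter_of_dominated_convergence (fun y => |t + c y|) ?_ ?_ ?_ ?_
  · exact .of_forall fun R =>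
      ((measurable_cutoffId R).comp (hcm.const_add t)).aestronglyMeasurable
  · exact .of_forall fun R => .of_forall fun y => norm_cutoffId_le_abs _ _
  · exact ((integrable_const t).add hc).abs
  · exact .of_forall fun y => tendsto_cutoffId _

/-- The averages of the translated truncations of the Liouvillian converge exactly on its domain,
to the Liouvillian shifted by the mean translation. -/
theorem strongLimit_integral_cutoffId (S : EquilibriumSystem H) (hcm : Measurable c)
    (hc : Integrable c ν) :
    (strongLimit fun R =>
        S.specL.integral (fun t => ∫ y, cutoffId R (t + c y) ∂ν) ∘L S.Q) =
      S.L + boundedOp (((∫ y, c y ∂ν : ℝ) : ℂ) • S.Q) := by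
  set m : ℂ := ((∫ y, c y ∂ν : ℝ) : ℂ)
  have hG (R : ℝ) := boundedMeasurable_integral_cutoffId (ν := ν) hcm R
  have hG' (R : ℝ) : BoundedMeasurable fun x : Fin 4 → ℝ => ∫ y, cutoffId R (x 0 + c y) ∂ν :=
    (hG R).comp (measurable_pi_apply 0)
  have hlim (ψ : S.L.domain) : Tendsto (fun R =>
      (S.specL.integral (fun t => ∫ y, cutoffId R (t + c y) ∂ν) ∘L S.Q) (ψ : H)) atTop
      (𝓝 (S.L ψ + m • S.Q ψ)) := by
    have h := CommutingTuple.tendsto_integral_op (A := S.P) (μ := 0) (l := atTop)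
      (F := fun R x => (∫ y, cutoffId R (x 0 + c y) ∂ν) - m) (c := 1)
      (d := (∫ y, |c y| ∂ν) + ‖m‖) (fun R => (hG' R).sub (.const m)) ?_ ?_
      ⟨S.Q ψ, (S.Q_mem_domain_iff ψ).2 ψ.2⟩
    · have h' := h.add_const (m • S.Q ψ)
      rw [show S.P.op 0 ⟨S.Q ψ, (S.Q_mem_domain_iff ψ).2 ψ.2⟩ = S.L ψ from S.L_Q_apply ψ] at h'
      refine h'.congr fun R => ?_
      rw [S.P.spec.integral_sub (hG' R) (.const m), PVM.integral_const,
        ContinuousLinearMap.comp_apply, S.specL_integral (hG R)]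
      simp
    · refine .of_forall fun R x => (norm_sub_le _ _).trans ?_
      linarith [norm_integral_cutoffId_le hc R (x 0)]
    · intro x
      have h := (tendsto_integral_cutoffId hcm hc (x 0)).sub_const m
      rwa [add_sub_cancel_right] at h
  refine LinearPMap.eq_of_eq_graph (SetLike.ext fun p => ?_)
  obtain ⟨z, w⟩ := p
  rw [mem_graph_strongLimit, LinearPMap.mem_graph_iff]
  constructor
  · intro h
    -- The converging averages satisfy Fatou's bound, which forces a finite second moment.
    have hz : z ∈ S.L.domain := by
      rw [← S.Q_mem_domain_iff]
      refine CommutingTuple.mem_domain_of_tendsto (A := S.P) (μ := 0) (χ := w)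
        (fun k : ℕ => hG' k) (fun x =>
          (tendsto_integral_cutoffId hcm hc (x 0)).comp tendsto_natCast_atTop_atTop) ?_
      refine (h.comp tendsto_natCast_atTop_atTop).congr fun k => ?_
      rw [Function.comp_apply, ContinuousLinearMap.comp_apply, S.specL_integral (hG k)]
    exact ⟨⟨z, hz, trivial⟩, rfl, (tendsto_nhds_unique h (hlim ⟨z, hz⟩)).symm⟩
  · rintro ⟨y, rfl, rfl⟩
    exact hlim ⟨y, y.2.1⟩

end Averaging

/-- The Liouvillian of the system in a constant electric field. -/
theorem deformedOp_electric (S : EquilibriumSystem H) (T : EquilibriumSystem K) (E : Fin 3 → ℝ)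
    (e : ℝ) (φ : NormalState K)
    (hφ : ∀ μ, Integrable (fun x : Fin 4 → ℝ => x μ) (φ.distribution T.X.spec)) :
    deformedOp φ (interaction (e • electricMatrix E) S.X T.X) S.specL =
      S.L + boundedOp
        (((e * ∫ x, ∑ k, E k * x k ∂φ.distribution T.specXSpatial : ℝ) : ℂ) • S.Q) := by
  have hc : Measurable fun y : Fin 4 → ℝ => e * ∑ k, E k * y k.succ := by fun_prop
  have hci : Integrable (fun y : Fin 4 → ℝ => e * ∑ k, E k * y k.succ)
      (φ.distribution T.X.spec) :=
    (integrable_finsetSum _ fun k _ => (hφ k.succ).const_mul (E k)).const_mul e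
  have hm : e * ∫ x, ∑ k, E k * x k ∂φ.distribution T.specXSpatial =
      ∫ y, e * ∑ k, E k * y k.succ ∂φ.distribution T.X.spec := by
    have h1 : Measurable fun (x : Fin 4 → ℝ) (k : Fin 3) => x k.succ := by fun_prop
    have h2 : Measurable fun x : Fin 3 → ℝ => ∑ k, E k * x k := by fun_prop
    rw [EquilibriumSystem.specXSpatial, φ.distribution_map, MeasureTheory.integral_map
      h1.aemeasurable h2.aestronglyMeasurable, MeasureTheory.integral_const_mul]
  rw [hm, ← strongLimit_integral_cutoffId S hc hci, deformedOp]
  congr 1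
  funext R
  have h0 (y : Fin 4 → ℝ) :
      (e • electricMatrix E).mulVec y 0 = -(e * ∑ k, E k * y k.succ) := by
    simp [Matrix.mulVec, dotProduct, electricMatrix, Fin.sum_univ_succ]
    ring
  have h := slice_conj_specL_integral S T.X (e • electricMatrix E) φ
    (BoundedMeasurable.cutoffId R) (by simp [cutoffId])
  simp only [h0, sub_neg_eq_add] at h
  exact h

end Liouvillian

/-! ### Generators on the tensor product -/

section TensorGenerator

theorem LinearPMap.sub_smul_mem_graph {G : Type*} [AddCommGroup G] [Module ℂ G]
    {A B : G →ₗ.[ℂ] G} {z w w' : G} (c : ℂ) (hA : (z, w) ∈ A.graph) (hB : (z, w') ∈ B.graph) :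
    (z, w - c • w') ∈ (A - c • B).graph := by
  rw [LinearPMap.mem_graph_iff] at hA hB ⊢
  obtain ⟨⟨y, hyA⟩, hy, hyw⟩ := hA
  obtain ⟨⟨y', hyB⟩, hy', hyw'⟩ := hB
  dsimp only at hy hyw hy' hyw'
  subst hy hyw hy' hyw'
  exact ⟨⟨y', hyA, hyB⟩, rfl, rfl⟩

theorem LinearPMap.exists_of_mem_graph_sub_smul {G : Type*} [AddCommGroup G] [Module ℂ G]
    {A B : G →ₗ.[ℂ] G} {z v : G} {c : ℂ} (h : (z, v) ∈ (A - c • B).graph) :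
    ∃ w w', (z, w) ∈ A.graph ∧ (z, w') ∈ B.graph ∧ v = w - c • w' := by
  rw [LinearPMap.mem_graph_iff] at h
  obtain ⟨y, hy, hyv⟩ := h
  dsimp only at hy hyv
  subst hy hyv
  exact ⟨A ⟨y, y.2.1⟩, B ⟨y, y.2.2⟩, A.mem_graph ⟨y, y.2.1⟩, B.mem_graph ⟨y, y.2.2⟩, rfl⟩

section

variable {G : Type*} [NormedAddCommGroup G] [InnerProductSpace ℂ G] [CompleteSpace G]

/-- Isometry follows from `U(a)* = U(-a)`. -/
theorem IsUnitaryGroup.of_adjoint {U : ℝ → G →L[ℂ] G} (h0 : U 0 = 1)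
    (hadd : ∀ a b, U (a + b) = U a * U b) (hadj : ∀ a, (U a).adjoint = U (-a)) :
    IsUnitaryGroup U where
  map_zero := h0
  map_add := hadd
  norm_map a z := ((U a).norm_map_iff_adjoint_comp_self).2
    (show (U a).adjoint * U a = 1 by rw [hadj, ← hadd, neg_add_cancel, h0]) z

theorem IsUnitaryGroup.conj {U : ℝ → G →L[ℂ] G} (hU : IsUnitaryGroup U)
    {W : G →L[ℂ] G} (hW : W ∈ unitary (G →L[ℂ] G)) :
    IsUnitaryGroup fun a => W.adjoint * U a * W where
  map_zero := by
    rw [hU.map_zero, mul_one]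
    exact Unitary.star_mul_self_of_mem hW
  map_add a b := by
    have h : W * W.adjoint = 1 := Unitary.mul_star_self_of_mem hW
    rw [hU.map_add, mul_assoc _ W, ← mul_assoc W, ← mul_assoc W, h, one_mul]
    simp only [mul_assoc]
  norm_map a z := by
    have h1 (z : G) : ‖W z‖ = ‖z‖ :=
      (W.norm_map_iff_adjoint_comp_self).2 (Unitary.star_mul_self_of_mem hW) z
    have h2 (z : G) : ‖W.adjoint z‖ = ‖z‖ :=
      (W.adjoint.norm_map_iff_adjoint_comp_self).2 (by
        rw [ContinuousLinearMap.adjoint_adjoint]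
        exact Unitary.mul_star_self_of_mem hW) z
    rw [mul_apply_eq_comp, mul_apply_eq_comp, h2, hU.norm_map, h1]

theorem IsStarProjection.norm_apply_le {T : G →L[ℂ] G} (hT : IsStarProjection T) (z : G) :
    ‖T z‖ ≤ ‖z‖ := by
  simpa using T.le_of_opNorm_le hT.norm_le z

end

variable {H K : Type*} [NormedAddCommGroup H] [InnerProductSpace ℂ H]
  [NormedAddCommGroup K] [InnerProductSpace ℂ K]

theorem mem_of_elem_mem_graph {Γ : Submodule ℂ (HilbertTensor H K × HilbertTensor H K)}
    (hΓ : IsClosed (Γ : Set (HilbertTensor H K × HilbertTensor H K)))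
    {F B : HilbertTensor H K →L[ℂ] HilbertTensor H K}
    (h : ∀ ψ η, (F (elem ψ η), B (elem ψ η)) ∈ Γ) (z : HilbertTensor H K) : (F z, B z) ∈ Γ := by
  have hcl : IsClosed ((Γ.comap ((F.prod B : HilbertTensor H K →L[ℂ] _) :
      HilbertTensor H K →ₗ[ℂ] HilbertTensor H K × HilbertTensor H K) :
        Submodule ℂ (HilbertTensor H K)) : Set (HilbertTensor H K)) :=
    hΓ.preimage (F.prod B).continuous
  exact HilbertTensor.mem_of_elem_mem hcl h z

/-- Strong convergence to `1` of contractions needs to be checked on elementary tensors only. -/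
theorem tendsto_of_elem {ι : Type*} {l : Filter ι}
    {F : ι → HilbertTensor H K →L[ℂ] HilbertTensor H K} (hF : ∀ i z, ‖F i z‖ ≤ ‖z‖)
    (h : ∀ ψ η, Tendsto (fun i => F i (elem ψ η)) l (𝓝 (elem ψ η))) (z : HilbertTensor H K) :
    Tendsto (fun i => F i z) l (𝓝 z) := by
  let V : Submodule ℂ (HilbertTensor H K) :=
    { carrier := {z | Tendsto (fun i => F i z) l (𝓝 z)}
      add_mem' := fun {z w} hz hw => by
        have : Tendsto (fun i => F i z + F i w) l (𝓝 (z + w)) := Tendsto.add hz hw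
        simpa using this
      zero_mem' := by simpa using tendsto_const_nhds
      smul_mem' := fun c z hz => by
        have : Tendsto (fun i => c • F i z) l (𝓝 (c • z)) := Tendsto.const_smul hz c
        simpa using this }
  have hV : IsClosed (V : Set (HilbertTensor H K)) := by
    refine isClosed_of_closure_subset fun z hz => ?_
    change Tendsto (fun i => F i z) l (𝓝 z)
    rw [Metric.tendsto_nhds]
    intro ε hε
    obtain ⟨w, hw, hzw⟩ := Metric.mem_closure_iff.1 hz (ε / 3) (by positivity)
    filter_upwards [Metric.tendsto_nhds.1 (show Tendsto (fun i => F i w) l (𝓝 w) from hw) (ε / 3)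
      (by positivity)] with i hi
    have hd : dist (F i z) (F i w) ≤ dist z w := by
      rw [dist_eq_norm, ← map_sub, dist_eq_norm]
      exact hF i _
    have h1 := dist_triangle4 (F i z) (F i w) w z
    rw [dist_comm w z] at h1
    linarith
  exact HilbertTensor.mem_of_elem_mem hV h z

/-- The tensor product of two operators is the generator of a unitary group that acts accordingly
on elementary tensors, if contractions approximating `1` commute with the group and map elementary
tensors to such with entries in the domains. -/
theorem tensorOp_eq_generator {A : H →ₗ.[ℂ] H} {B : K →ₗ.[ℂ] K}
    {U : ℝ → HilbertTensor H K →L[ℂ] HilbertTensor H K} (hU : IsUnitaryGroup U)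
    (hAB : ∀ (ψ : A.domain) (η : B.domain),
      (elem (ψ : H) (η : K), elem (A ψ) (B η)) ∈ generatorGraph U)
    {F C : ℕ → HilbertTensor H K →L[ℂ] HilbertTensor H K}
    (hF : ∀ n z, ‖F n z‖ ≤ ‖z‖)
    (hlim : ∀ ψ η, Tendsto (fun n => F n (elem ψ η)) atTop (𝓝 (elem ψ η)))
    (hcomm : ∀ n a, F n * U a = U a * F n)
    (hFC : ∀ n ψ η, ∃ (ψ' : A.domain) (η' : B.domain),
      F n (elem ψ η) = elem (ψ' : H) (η' : K) ∧ C n (elem ψ η) = elem (A ψ') (B η')) :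
    tensorOp A B = generator U := by
  rw [tensorOp, generator]
  congr 1
  refine hU.topologicalClosure_eq_generatorGraph (Submodule.span_le.2 ?_) (tendsto_of_elem hF hlim)
    hcomm fun n z => ⟨C n z, mem_of_elem_mem_graph (Submodule.isClosed_topologicalClosure _)
      (fun ψ η => ?_) z⟩
  · rintro _ ⟨ψ, η, rfl⟩
    exact hAB ψ η
  · obtain ⟨ψ', η', h1, h2⟩ := hFC n ψ η
    rw [h1, h2]
    exact Submodule.le_topologicalClosure _ (Submodule.subset_span ⟨ψ', η', rfl⟩)

variable [CompleteSpace H]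

variable {n : ℕ}

/-- The cut-off projections `1_{[-R,R]}(A_μ)` commute with the functions of the tuple. -/
theorem CommutingTuple.proj_slab_mul_comm (A : CommutingTuple n H) (μ : Fin n) (R : ℝ)
    {f : (Fin n → ℝ) → ℂ} (hf : BoundedMeasurable f) :
    A.spec.proj (slab μ R) * A.spec.integral f = A.spec.integral f * A.spec.proj (slab μ R) := by
  rw [← A.spec.integral_indicator_one (measurableSet_slab μ R)]
  exact A.spec.integral_mul_comm
    ((BoundedMeasurable.const 1).indicator (measurableSet_slab μ R)) hf

theorem CommutingTuple.proj_slab_mul_exp (A : CommutingTuple n H) (μ : Fin n) (R : ℝ)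
    (p : Fin n → ℝ) :
    A.spec.proj (slab μ R) * A.spec.exp p = A.spec.exp p * A.spec.proj (slab μ R) :=
  A.proj_slab_mul_comm μ R (boundedMeasurable_phase p)

/-- The unitary group `e^{iaA_μ} ⊗ 1`. -/
noncomputable def leftGroup (K : Type*) [NormedAddCommGroup K] [InnerProductSpace ℂ K]
    (A : CommutingTuple n H) (μ : Fin n) (a : ℝ) : HilbertTensor H K →L[ℂ] HilbertTensor H K :=
  opTensor (A.spec.exp (Pi.single μ a)) 1

theorem elem_mem_generatorGraph_leftGroup (A : CommutingTuple n H) (μ : Fin n)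
    (ψ : (A.op μ).domain) (η : K) :
    (elem (ψ : H) η, elem (A.op μ ψ) η) ∈ generatorGraph (leftGroup K A μ) := by
  have h := ((insertRight H η).restrictScalars ℝ).hasFDerivAt.comp_hasDerivAt 0
    (A.hasDerivAt_exp μ ψ)
  rw [mem_generatorGraph]
  convert h using 1
  · funext a
    simp [leftGroup, opTensor_elem, insertRight_apply]
  · simp [insertRight_apply]

variable [CompleteSpace K]

theorem adjoint_opTensor (A : H →L[ℂ] H) (B : K →L[ℂ] K) :
    (opTensor A B).adjoint = opTensor A.adjoint B.adjoint :=
  ContinuousLinearMap.ext_inner_elem fun ψ η => by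
    simp [ContinuousLinearMap.adjoint_inner_right, opTensor_elem, inner_elem_elem]

theorem IsStarProjection.opTensor {A : H →L[ℂ] H} {B : K →L[ℂ] K} (hA : IsStarProjection A)
    (hB : IsStarProjection B) : IsStarProjection (opTensor A B) where
  isIdempotentElem := by
    rw [IsIdempotentElem, ← opTensor_mul, hA.isIdempotentElem.eq, hB.isIdempotentElem.eq]
  isSelfAdjoint := by
    rw [ContinuousLinearMap.isSelfAdjoint_iff', adjoint_opTensor, hA.isSelfAdjoint.adjoint_eq,
      hB.isSelfAdjoint.adjoint_eq]

theorem isUnitaryGroup_leftGroup (A : CommutingTuple n H) (μ : Fin n) :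
    IsUnitaryGroup (leftGroup K A μ) := by
  refine .of_adjoint ?_ (fun a b => ?_) fun a => ?_
  · rw [leftGroup, Pi.single_zero, PVM.exp_zero, opTensor_one_one]
  · rw [leftGroup, leftGroup, leftGroup, Pi.single_add, PVM.exp_add, ← opTensor_mul, mul_one]
  · rw [leftGroup, leftGroup, adjoint_opTensor, PVM.adjoint_exp, Pi.single_neg,
      IsSelfAdjoint.adjoint_eq (.one _)]

theorem tendsto_leftGroup (A : CommutingTuple n H) (μ : Fin n) (z : HilbertTensor H K) :
    Tendsto (fun a => leftGroup K A μ a z) (𝓝 0) (𝓝 z) := by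
  refine tendsto_of_elem (fun a z => ((isUnitaryGroup_leftGroup A μ).norm_map a z).le)
    (fun ψ η => ?_) z
  have h1 : Continuous fun a : ℝ => insertRight H η (A.spec.exp (Pi.single μ a) ψ) :=
    (insertRight H η).continuous.comp
      ((A.spec.continuous_exp_apply ψ).comp (continuous_single (A := fun _ => ℝ) μ))
  have h2 := h1.tendsto 0
  simp only [Pi.single_zero, PVM.exp_zero, one_apply_eq_self, insertRight_apply] at h2
  simpa only [leftGroup, opTensor_elem, one_apply_eq_self] using h2

theorem isStarProjection_proj_slab (A : CommutingTuple n H) (μ : Fin n) (R : ℝ) :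
    IsStarProjection (A.spec.proj (CommutingTuple.slab μ R)) :=
  A.spec.isStarProjection _ (CommutingTuple.measurableSet_slab μ R)

theorem tendsto_proj_slab_natCast (A : CommutingTuple n H) (μ : Fin n) (ψ : H) :
    Tendsto (fun k : ℕ => A.spec.proj (CommutingTuple.slab μ k) ψ) atTop (𝓝 ψ) :=
  (A.tendsto_proj_slab μ ψ).comp tendsto_natCast_atTop_atTop

theorem tensorOp_op_one (A : CommutingTuple n H) (μ : Fin n) :
    tensorOp (A.op μ) (boundedOp (1 : K →L[ℂ] K)) = generator (leftGroup K A μ) := by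
  refine tensorOp_eq_generator (isUnitaryGroup_leftGroup A μ)
    (fun ψ η => elem_mem_generatorGraph_leftGroup A μ ψ (η : K))
    (F := fun k => opTensor (A.spec.proj (CommutingTuple.slab μ k)) 1)
    (C := fun k => opTensor (A.truncated μ k) 1)
    (fun k z => ((isStarProjection_proj_slab A μ k).opTensor (.one _)).norm_apply_le z)
    (fun ψ η => ?_) (fun k a => ?_) fun k ψ η => ?_
  · simpa only [opTensor_elem, one_apply_eq_self, Function.comp_def, insertRight_apply] using
      ((insertRight H η).continuous.tendsto ψ).comp (tendsto_proj_slab_natCast A μ ψ)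
  · rw [leftGroup, ← opTensor_mul, ← opTensor_mul, A.proj_slab_mul_exp]
  · exact ⟨⟨_, A.proj_slab_mem_domain μ k ψ⟩, ⟨η, trivial⟩, by
      rw [opTensor_elem, one_apply_eq_self], by
      rw [opTensor_elem, CommutingTuple.op_proj_slab]; rfl⟩

end TensorGenerator

/-! ### The deformed momenta -/

section Momentum

variable {H K : Type*} [NormedAddCommGroup H] [InnerProductSpace ℂ H]
  [NormedAddCommGroup K] [InnerProductSpace ℂ K] [CompleteSpace K] {n : ℕ}

/-- The unitary group `e^{ia Q ⊗ Y_ν} = Q ⊗ e^{iaY_ν} + (1 - Q) ⊗ 1` of a projection `Q`. -/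
noncomputable def rightGroup (Q : H →L[ℂ] H) (Y : CommutingTuple n K) (ν : Fin n) (a : ℝ) :
    HilbertTensor H K →L[ℂ] HilbertTensor H K :=
  opTensor Q (Y.spec.exp (Pi.single ν a)) + opTensor (1 - Q) 1

theorem rightGroup_elem (Q : H →L[ℂ] H) (Y : CommutingTuple n K) (ν : Fin n) (a : ℝ) (ψ : H)
    (η : K) : rightGroup Q Y ν a (elem ψ η) =
      elem (Q ψ) (Y.spec.exp (Pi.single ν a) η) + elem (ψ - Q ψ) η := by
  simp [rightGroup, opTensor_elem]

theorem rightGroup_zero (Q : H →L[ℂ] H) (Y : CommutingTuple n K) (ν : Fin n) :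
    rightGroup Q Y ν 0 = 1 :=
  ContinuousLinearMap.ext_elem fun ψ η => by
    rw [rightGroup_elem, Pi.single_zero, PVM.exp_zero, one_apply_eq_self, ← elem_add_left,
      add_sub_cancel, one_apply_eq_self]

theorem elem_mem_generatorGraph_rightGroup (Q : H →L[ℂ] H) (Y : CommutingTuple n K) (ν : Fin n)
    (ψ : H) (η : (Y.op ν).domain) :
    (elem ψ (η : K), elem (Q ψ) (Y.op ν η)) ∈ generatorGraph (rightGroup Q Y ν) := by
  have h := (((elemL H K (Q ψ)).restrictScalars ℝ).hasFDerivAt.comp_hasDerivAt 0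
    (Y.hasDerivAt_exp ν η)).add_const (elem (ψ - Q ψ) (η : K))
  rw [mem_generatorGraph]
  convert h using 1
  · funext a
    exact rightGroup_elem _ _ _ _ _ _
  · simp [elemL_apply]

variable [CompleteSpace H]

theorem isUnitaryGroup_rightGroup {Q : H →L[ℂ] H} (hQ : IsStarProjection Q)
    (Y : CommutingTuple n K) (ν : Fin n) : IsUnitaryGroup (rightGroup Q Y ν) := by
  refine .of_adjoint (rightGroup_zero Q Y ν) (fun a b => ?_) fun a => ?_
  · refine ContinuousLinearMap.ext_elem fun ψ η => ?_
    have hQQ : Q (Q ψ) = Q ψ := congrArg (fun T : H →L[ℂ] H => T ψ) hQ.isIdempotentElem.eq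
    have h0 (χ : K) : elem (0 : H) χ = 0 := by rw [← elemL_apply, map_zero, zero_apply]
    rw [mul_apply_eq_comp, rightGroup_elem, rightGroup_elem, map_add, rightGroup_elem,
      rightGroup_elem, Pi.single_add, PVM.exp_add, mul_apply_eq_comp, hQQ, map_sub, hQQ, sub_self,
      h0, h0, sub_zero, add_zero, zero_add]
  · have h1 : (1 : H →L[ℂ] H).adjoint = 1 := IsSelfAdjoint.adjoint_eq (.one _)
    have h2 : (1 : K →L[ℂ] K).adjoint = 1 := IsSelfAdjoint.adjoint_eq (.one _)
    rw [rightGroup, map_add, adjoint_opTensor, adjoint_opTensor, PVM.adjoint_exp, rightGroup,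
      Pi.single_neg, map_sub, h1, h2, hQ.isSelfAdjoint.adjoint_eq]

theorem tensorOp_boundedOp_op {Q : H →L[ℂ] H} (hQ : IsStarProjection Q)
    (Y : CommutingTuple n K) (ν : Fin n) :
    tensorOp (boundedOp Q) (Y.op ν) = generator (rightGroup Q Y ν) := by
  refine tensorOp_eq_generator (isUnitaryGroup_rightGroup hQ Y ν)
    (fun ψ η => elem_mem_generatorGraph_rightGroup Q Y ν (ψ : H) η)
    (F := fun k => opTensor 1 (Y.spec.proj (CommutingTuple.slab ν k)))
    (C := fun k => opTensor Q (Y.truncated ν k))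
    (fun k z => ((IsStarProjection.one _).opTensor
      (isStarProjection_proj_slab Y ν k)).norm_apply_le z)
    (fun ψ η => ?_) (fun k a => ?_) fun k ψ η => ?_
  · simpa only [opTensor_elem, one_apply_eq_self, Function.comp_def, elemL_apply] using
      ((elemL H K ψ).continuous.tendsto η).comp (tendsto_proj_slab_natCast Y ν η)
  · rw [rightGroup, mul_add, add_mul, ← opTensor_mul, ← opTensor_mul, ← opTensor_mul,
      ← opTensor_mul, Y.proj_slab_mul_exp]
    simp only [one_mul, mul_one]
  · exact ⟨⟨ψ, trivial⟩, ⟨_, Y.proj_slab_mem_domain ν k η⟩, by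
      rw [opTensor_elem, one_apply_eq_self], by
      rw [opTensor_elem, CommutingTuple.op_proj_slab]; rfl⟩

theorem EquilibriumSystem.isStarProjection_Q (S : EquilibriumSystem H) : IsStarProjection S.Q :=
  isStarProjection_starProjection

theorem EquilibriumSystem.proj_slab_mul_Q (S : EquilibriumSystem H) (μ : Fin 4) (R : ℝ) :
    S.P.spec.proj (CommutingTuple.slab μ R) * S.Q =
      S.Q * S.P.spec.proj (CommutingTuple.slab μ R) := by
  ext ψ
  have hms := CommutingTuple.measurableSet_slab μ R
  rw [← S.P.spec.integral_indicator_one hms]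
  exact (S.Q_integral S.P_Ω ((BoundedMeasurable.const 1).indicator hms) ψ).symm

/-- Conjugation with the interaction unitary multiplies the translation group in the direction `μ`
by the group of `Q ⊗ Y_ν`, when only the `ν`-th entry of the `μ`-th row of the matrix is nonzero. -/
theorem conj_leftGroup (S : EquilibriumSystem H) (Y : CommutingTuple n K)
    {M : Matrix (Fin 4) (Fin n) ℝ} {μ : Fin 4} {ν : Fin n} {c : ℝ}
    (hM : ∀ y, M.mulVec y μ = c * y ν) (a : ℝ) :
    (interaction M S.X Y).adjoint * leftGroup K S.P μ a * interaction M S.X Y =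
      leftGroup K S.P μ a * rightGroup S.Q Y ν (-(c * a)) := by
  refine ContinuousLinearMap.ext_inner_elem fun ψ η => ?_
  have hph (y : Fin n → ℝ) : phase (-(M.mulVec y)) (Pi.single μ a) =
      phase (Pi.single ν (-(c * a))) y := by
    rw [phase_single, phase, Finset.sum_eq_single μ (fun ρ _ hρ => by simp [hρ]) (by simp)]
    rw [Pi.neg_apply, Pi.single_eq_same, hM]
    congr 3
    ring
  have hfib (y : Fin n → ℝ) :
      ⟪S.X.spec.exp (-(M.mulVec y)) ψ, S.P.spec.exp (Pi.single μ a)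
        (S.X.spec.exp (-(M.mulVec y)) ψ)⟫_ℂ =
      ⟪ψ, S.P.spec.exp (Pi.single μ a) (ψ - S.Q ψ)⟫_ℂ +
        phase (Pi.single ν (-(c * a))) y * ⟪ψ, S.P.spec.exp (Pi.single μ a) (S.Q ψ)⟫_ℂ := by
    rw [← PVM.adjoint_exp, ContinuousLinearMap.adjoint_inner_left, PVM.adjoint_exp,
      S.exp_X_exp_P_exp_X_neg, inner_add_right, inner_smul_right, hph]
  rw [mul_apply_eq_comp, mul_apply_eq_comp, ContinuousLinearMap.adjoint_inner_right, leftGroup,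
    ← tensorOne_eq_opTensor, (interaction_spec M S.X Y).2]
  have hη : ⟪η, η⟫_ℂ = ((‖η‖ ^ 2 : ℝ) : ℂ) := by
    rw [inner_self_eq_norm_sq_to_K]
    push_cast
    rfl
  simp_rw [hfib]
  rw [integral_add (integrable_const _) (((boundedMeasurable_phase _).integrable _).mul_const _),
    MeasureTheory.integral_const, MeasureTheory.integral_mul_const, Y.spec.measureReal_univ,
    mul_apply_eq_comp, rightGroup_elem, map_add, tensorOne_elem, tensorOne_elem, inner_add_right,
    inner_elem_elem, inner_elem_elem, PVM.exp_eq Y.spec,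
    Y.spec.inner_integral (boundedMeasurable_phase _), hη, Complex.real_smul]
  ring

/-- The conjugate of `P_μ ⊗ 1` is the closure of `P_μ ⊗ 1 - c Q ⊗ Y_ν`: both are the generator of
the product of the two commuting unitary groups. -/
theorem closure_sub_eq_generator (S : EquilibriumSystem H) (Y : CommutingTuple n K)
    {M : Matrix (Fin 4) (Fin n) ℝ} {μ : Fin 4} {ν : Fin n} {c : ℝ}
    (hM : ∀ y, M.mulVec y μ = c * y ν) :
    (tensorOp (S.P.op μ) (boundedOp 1) - (c : ℂ) • tensorOp (boundedOp S.Q) (Y.op ν)).closure =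
      generator fun a => leftGroup K S.P μ a * rightGroup S.Q Y ν (-(c * a)) := by
  have hU := (isUnitaryGroup_leftGroup (K := K) S.P μ).conj (interaction_spec M S.X Y).1
  simp_rw [conj_leftGroup S Y hM] at hU
  rw [tensorOp_op_one, tensorOp_boundedOp_op S.isStarProjection_Q]
  set D := generator (leftGroup K S.P μ) - (c : ℂ) • generator (rightGroup S.Q Y ν)
  have hD : D.graph ≤ generatorGraph fun a =>
      leftGroup K S.P μ a * rightGroup S.Q Y ν (-(c * a)) := by
    rintro ⟨z, v⟩ hz
    obtain ⟨w, w', hw, hw', rfl⟩ := LinearPMap.exists_of_mem_graph_sub_smul hz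
    rw [graph_generator] at hw hw'
    rw [mem_generatorGraph] at hw'
    have hsc : HasDerivAt (fun a : ℝ => -(c * a)) (-c) 0 := by
      have h := ((hasDerivAt_id (0 : ℝ)).const_mul c).neg
      rw [mul_one] at h
      exact h
    have hr : HasDerivAt (fun a => rightGroup S.Q Y ν (-(c * a)) z) (-c • Complex.I • w') 0 :=
      HasDerivAt.scomp (g₁ := fun a => rightGroup S.Q Y ν a z) (h := fun a : ℝ => -(c * a))
        (0 : ℝ) (by simpa using hw') hsc
    have h := hasDerivAt_apply_apply
      (V := fun a => rightGroup S.Q Y ν (-(c * a)))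
      (isUnitaryGroup_leftGroup (K := K) S.P μ).norm_map
      (tendsto_leftGroup S.P μ) (by simp [rightGroup_zero]) (mem_generatorGraph.1 hw) hr
    rw [mem_generatorGraph]
    refine h.congr_deriv ?_
    rw [smul_sub, sub_eq_add_neg, smul_comm Complex.I (c : ℂ), Complex.coe_smul]
    exact congrArg _ (neg_smul c _)
  have hcore : D.graph.topologicalClosure = generatorGraph fun a =>
      leftGroup K S.P μ a * rightGroup S.Q Y ν (-(c * a)) := by
    -- The projections onto bounded parts of the spectra of `P_μ` and `Y_ν` approximate `1`.
    have hproj (k : ℕ) := (isStarProjection_proj_slab S.P μ k).opTensor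
      (isStarProjection_proj_slab Y ν k)
    refine hU.topologicalClosure_eq_generatorGraph hD
      (F := fun k : ℕ => opTensor (S.P.spec.proj (CommutingTuple.slab μ k))
        (Y.spec.proj (CommutingTuple.slab ν k)))
      (tendsto_of_elem (fun k => (hproj k).norm_apply_le) fun ψ η => ?_) (fun k a => ?_)
      fun k z => ⟨_, mem_of_elem_mem_graph (Submodule.isClosed_topologicalClosure _)
        (B := opTensor (S.P.truncated μ k) (Y.spec.proj (CommutingTuple.slab ν k)) -
          (c : ℂ) • opTensor (S.Q * S.P.spec.proj (CommutingTuple.slab μ k)) (Y.truncated ν k))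
        (fun ψ η => Submodule.le_topologicalClosure _ ?_) z⟩
    · have h1 := ((elemL H K).continuous₂.tendsto (ψ, η)).comp
        ((tendsto_proj_slab_natCast S.P μ ψ).prodMk_nhds (tendsto_proj_slab_natCast Y ν η))
      simpa only [opTensor_elem, Function.comp_def, Function.uncurry, elemL_apply] using h1
    · have h1 : Commute (S.P.spec.proj (CommutingTuple.slab μ k)) S.Q := S.proj_slab_mul_Q μ k
      have h2 : Commute (S.P.spec.proj (CommutingTuple.slab μ k))
          (S.P.spec.exp (Pi.single μ a)) := S.P.proj_slab_mul_exp μ k _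
      rw [leftGroup, rightGroup, mul_add, ← opTensor_mul, ← opTensor_mul, one_mul, one_mul,
        mul_add, add_mul, ← opTensor_mul, ← opTensor_mul, ← opTensor_mul, ← opTensor_mul,
        (h2.mul_right h1).eq, (h2.mul_right ((Commute.one_right _).sub_right h1)).eq,
        Y.proj_slab_mul_exp, one_mul, mul_one]
    · have hA : (elem (S.P.spec.proj (CommutingTuple.slab μ k) ψ)
          (Y.spec.proj (CommutingTuple.slab ν k) η), elem (S.P.truncated μ k ψ)
          (Y.spec.proj (CommutingTuple.slab ν k) η)) ∈ (generator (leftGroup K S.P μ)).graph := by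
        rw [graph_generator, ← S.P.op_proj_slab]
        exact elem_mem_generatorGraph_leftGroup S.P μ ⟨_, S.P.proj_slab_mem_domain μ k ψ⟩ _
      have hB : (elem (S.P.spec.proj (CommutingTuple.slab μ k) ψ)
          (Y.spec.proj (CommutingTuple.slab ν k) η),
          elem (S.Q (S.P.spec.proj (CommutingTuple.slab μ k) ψ)) (Y.truncated ν k η)) ∈
            (generator (rightGroup S.Q Y ν)).graph := by
        rw [graph_generator, ← Y.op_proj_slab]
        exact elem_mem_generatorGraph_rightGroup S.Q Y ν _ ⟨_, Y.proj_slab_mem_domain ν k η⟩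
      simpa only [opTensor_elem, sub_apply, smul_apply, mul_apply_eq_comp] using
        LinearPMap.sub_smul_mem_graph (c : ℂ) hA hB
  have hcl : D.IsClosable := ⟨generator fun a =>
    leftGroup K S.P μ a * rightGroup S.Q Y ν (-(c * a)), by rw [hcore, graph_generator]⟩
  refine LinearPMap.eq_of_eq_graph ?_
  rw [← hcl.graph_closure_eq_closure_graph, hcore, graph_generator]

/-- The conjugate of `P_μ ⊗ 1` with the interaction unitary depends on the `μ`-th row of the matrix
only. -/
theorem unitaryConj_interaction (S : EquilibriumSystem H) (Y : CommutingTuple n K)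
    {M : Matrix (Fin 4) (Fin n) ℝ} {μ : Fin 4} {ν : Fin n} {c : ℝ}
    (hM : ∀ y, M.mulVec y μ = c * y ν) :
    unitaryConj (interaction M S.X Y) (tensorOp (S.P.op μ) (boundedOp 1)) =
      (tensorOp (S.P.op μ) (boundedOp 1) - (c : ℂ) • tensorOp (boundedOp S.Q)
        (Y.op ν)).closure := by
  rw [closure_sub_eq_generator S Y hM, tensorOp_op_one,
    unitaryConj_generator (interaction_spec M S.X Y).1]
  simp_rw [conj_leftGroup S Y hM]

end Momentum

theorem mainTheorem2 {H K : Type*}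
    [NormedAddCommGroup H] [InnerProductSpace ℂ H] [CompleteSpace H]
    [NormedAddCommGroup K] [InnerProductSpace ℂ K] [CompleteSpace K]
    (S : EquilibriumSystem H) (T : EquilibriumSystem K) (E : Fin 3 → ℝ) (e : ℝ) :
    interaction (e • electricMatrix E) S.X T.X ∈
        unitary (HilbertTensor H K →L[ℂ] HilbertTensor H K) ∧
    (∀ φ : NormalState K,
      (∀ μ, Integrable (fun x : Fin 4 → ℝ => x μ) (φ.distribution T.X.spec)) →
      deformedOp φ (interaction (e • electricMatrix E) S.X T.X) S.specL =
        S.L + boundedOp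
          (((e * ∫ x, ∑ k, E k * x k ∂φ.distribution T.specXSpatial : ℝ) : ℂ) • S.Q)) ∧
    (∀ k : Fin 3,
      unitaryConj (interaction (electricMatrix E) S.X T.X)
          (tensorOp (S.P.op k.succ) (boundedOp 1)) =
        unitaryConj (interaction (Matrix.single k.succ 0 (E k)) S.X T.X)
          (tensorOp (S.P.op k.succ) (boundedOp 1)) ∧
      unitaryConj (interaction (electricMatrix E) S.X T.X)
          (tensorOp (S.P.op k.succ) (boundedOp 1)) =
        (tensorOp (S.P.op k.succ) (boundedOp 1) -
          ((E k : ℝ) : ℂ) • tensorOp (boundedOp S.Q) (T.X.op 0)).closure) := by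
  refine ⟨(interaction_spec _ S.X T.X).1, fun φ hφ => deformedOp_electric S T E e φ hφ,
    fun k => ?_⟩
  have h1 (y : Fin 4 → ℝ) : (electricMatrix E).mulVec y k.succ = E k * y 0 := by
    fin_cases k <;> simp [Matrix.mulVec, dotProduct, electricMatrix, Fin.sum_univ_succ]
  have h2 (y : Fin 4 → ℝ) :
      (Matrix.single k.succ 0 (E k) : Matrix (Fin 4) (Fin 4) ℝ).mulVec y k.succ = E k * y 0 := by
    simp [Matrix.single_mulVec]
  rw [unitaryConj_interaction S T.X h1, unitaryConj_interaction S T.X h2]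
  exact ⟨rfl, rfl⟩
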